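/- Write $\widehat f(\xi)=\int_{\mathbb R} f(x)e^{-2\pi i x\xi}\,dx$, extended to tempered distributions, and let $M^{1,1}(\mathbb R)$ be the modulation space (Feichtinger algebra) of all tempered distributions $f$ whose short-time Fourier transform $V_{\mathfrak g}f(t,\nu)=\langle f,\, e^{2\pi i\nu\,\cdot}\,\mathfrak g(\cdot-t)\rangle$ with Gaussian window $\mathfrak g(x)=2^{1/4}e^{-\pi x^2}$ belongs to $L^1(\mathbb R^2)$; its elements are continuous integrable functions. Let $1\le p\le\infty$ and let $T,\Omega>0$ satisfy $T\Omega<1$. Call $s\in M^{1,1}(\mathbb R)$ admissible if $\operatorname{supp}\widehat s\subseteq[-\tfrac1{2T},\tfrac1{2T})$ and $\widehat s\equiv T$ on $[-\tfrac\Omega2,\tfrac\Omega2)$. Then admissible $s$ exist, and there are constants $A,B>0$, depending only on $p,T,\Omega$, such that for every $m\in L^p(\mathbb R)$ with $\operatorname{supp}\widehat m\subseteq[-\tfrac\Omega2,\tfrac\Omega2)$ the following holds. The function $m$ has a continuous representative, again denoted by $m$; $$A\,\|m\|_{L^p}\le\|\{m(kT)\}_{k\in\mathbb Z}\|_{\ell^p}\le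 B\,\|m\|_{L^p};$$ and for every admissible $s$ $$m(x)=\sum_{k\in\mathbb Z}m(kT)\,s(x-kT)\qquad\text{for every }x\in\mathbb R,$$ where the series converges unconditionally at every point $x$, and moreover unconditionally in $L^p(\mathbb R)$ if $p<\infty$, respectively in the weak-$*$ topology of $L^\infty(\mathbb R)=L^1(\mathbb R)'$ if $p=\infty$. -/

import Mathlib

open scoped FourierTransform SchwartzMap ENNReal NNReal
open MeasureTheory

/-- All derivatives of `x ↦ c * exp (-π x ^ 2 + b x)` are a polynomial times that exponential. -/
theorem iteratedDeriv_gaussian_form (c b : ℂ) (n : ℕ) :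
    ∃ P : Polynomial ℂ, ∀ x : ℝ,
      iteratedDeriv n (fun y : ℝ => c * Complex.exp (-Real.pi * (y : ℂ) ^ 2 + b * y)) x =
        P.eval (x : ℂ) * Complex.exp (-Real.pi * (x : ℂ) ^ 2 + b * x) := by
  induction n with
  | zero => exact ⟨Polynomial.C c, fun x => by simp⟩
  | succ n ih =>
    obtain ⟨P, hP⟩ := ih
    refine ⟨Polynomial.derivative P +
      P * (Polynomial.C (-2 * (Real.pi : ℂ)) * Polynomial.X + Polynomial.C b), fun x => ?_⟩
    rw [iteratedDeriv_succ, funext hP]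
    have hx : HasDerivAt (fun y : ℝ => (y : ℂ)) 1 x := Complex.ofRealCLM.hasDerivAt
    have h1 : HasDerivAt (fun y : ℝ => P.eval (y : ℂ))
        ((Polynomial.derivative P).eval (x : ℂ)) x := by
      have h := (P.hasDerivAt (x : ℂ)).comp x hx
      rw [mul_one] at h
      exact h
    have h2 : HasDerivAt (fun y : ℝ => -Real.pi * (y : ℂ) ^ 2 + b * y)
        (-Real.pi * (2 * (x : ℂ)) + b) x := by
      have h := ((hx.pow 2).const_mul (-Real.pi : ℂ)).add (hx.const_mul b)
      have e : -(Real.pi : ℂ) * (2 * (x : ℂ)) + b =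
          -(Real.pi : ℂ) * ((2 : ℕ) * (x : ℂ) ^ (2 - 1) * 1) + b * 1 := by norm_num
      rw [e]
      exact h
    refine (h1.mul h2.cexp).deriv.trans ?_
    simp
    ring

/-- Powers are dominated by the Gaussian exponential. -/
theorem pow_mul_gaussian_bounded (b : ℂ) (j : ℕ) :
    ∃ C : ℝ, ∀ x : ℝ,
      |x| ^ j * ‖Complex.exp (-Real.pi * (x : ℂ) ^ 2 + b * x)‖ ≤ C := by
  refine ⟨j.factorial * Real.exp ((|b.re| + 1) ^ 2), fun x => ?_⟩
  have hre : (-Real.pi * (x : ℂ) ^ 2 + b * x).re = -Real.pi * x ^ 2 + b.re * x := by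
    rw [← Complex.ofReal_pow, ← Complex.ofReal_neg, ← Complex.ofReal_mul, Complex.add_re,
      Complex.ofReal_re, Complex.re_mul_ofReal]
  rw [Complex.norm_exp, hre]
  have h1 : -Real.pi * x ^ 2 + b.re * x ≤ (|b.re| + 1) ^ 2 - |x| := by
    have h2 : b.re * x ≤ |b.re| * |x| := by rw [← abs_mul]; exact le_abs_self _
    have h3 : |x| ^ 2 = x ^ 2 := sq_abs x
    nlinarith [Real.pi_gt_three, sq_nonneg (|x| - (|b.re| + 1) / 2), sq_nonneg (|b.re| + 1),
      sq_nonneg x, mul_nonneg (sub_nonneg.2 Real.pi_gt_three.le) (sq_nonneg x)]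
  have h4 : |x| ^ j ≤ j.factorial * Real.exp |x| := by
    have := Real.pow_div_factorial_le_exp |x| (abs_nonneg x) j
    rwa [div_le_iff₀ (by positivity), mul_comm] at this
  calc |x| ^ j * Real.exp (-Real.pi * x ^ 2 + b.re * x)
      ≤ (j.factorial * Real.exp |x|) * Real.exp ((|b.re| + 1) ^ 2 - |x|) := by gcongr
    _ = j.factorial * Real.exp ((|b.re| + 1) ^ 2) := by
      rw [mul_assoc, ← Real.exp_add]; ring_nf

/-- The functions `x ↦ c * exp (-π x ^ 2 + b x)` have the decay of Schwartz functions. -/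
theorem gaussian_form_decay (c b : ℂ) (k n : ℕ) :
    ∃ C : ℝ, ∀ x : ℝ, ‖x‖ ^ k * ‖iteratedFDeriv ℝ n
      (fun y : ℝ => c * Complex.exp (-Real.pi * (y : ℂ) ^ 2 + b * y)) x‖ ≤ C := by
  obtain ⟨P, hP⟩ := iteratedDeriv_gaussian_form c b n
  choose C hC using pow_mul_gaussian_bounded b
  refine ⟨∑ i ∈ Finset.range (P.natDegree + 1), ‖P.coeff i‖ * C (k + i), fun x => ?_⟩
  rw [norm_iteratedFDeriv_eq_norm_iteratedDeriv, hP, Polynomial.eval_eq_sum_range, norm_mul]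
  calc ‖x‖ ^ k * (‖∑ i ∈ Finset.range (P.natDegree + 1), P.coeff i * (x : ℂ) ^ i‖ *
        ‖Complex.exp (-Real.pi * (x : ℂ) ^ 2 + b * x)‖)
      ≤ ‖x‖ ^ k * ((∑ i ∈ Finset.range (P.natDegree + 1), ‖P.coeff i * (x : ℂ) ^ i‖) *
        ‖Complex.exp (-Real.pi * (x : ℂ) ^ 2 + b * x)‖) := by
        gcongr; exact norm_sum_le _ _
    _ = ∑ i ∈ Finset.range (P.natDegree + 1), ‖P.coeff i‖ *
        (|x| ^ (k + i) * ‖Complex.exp (-Real.pi * (x : ℂ) ^ 2 + b * x)‖) := by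
        rw [Finset.sum_mul, Finset.mul_sum]
        refine Finset.sum_congr rfl fun i _ => ?_
        rw [norm_mul, norm_pow, Complex.norm_real, Real.norm_eq_abs, pow_add]
        ring
    _ ≤ _ := by
        refine Finset.sum_le_sum fun i _ => ?_
        exact mul_le_mul_of_nonneg_left (hC _ x) (norm_nonneg _)

/-- The time-frequency shifted Gaussian `(π(t,ν) 𝔤)(x) = exp (2πiνx) 𝔤(x - t)`, where
`𝔤(x) = 2 ^ (1/4) exp (-π x ^ 2)` is the normalized Gaussian on `ℝ`. -/
noncomputable def tfGaussian (t ν x : ℝ) : ℂ :=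
  Complex.exp (2 * Real.pi * Complex.I * ν * x) *
    (((2 : ℝ) ^ (1 / 4 : ℝ) * Real.exp (-Real.pi * (x - t) ^ 2) : ℝ) : ℂ)

theorem conj_tfGaussian_eq (t ν : ℝ) :
    (fun x : ℝ => (starRingEnd ℂ) (tfGaussian t ν x)) =
      fun x : ℝ => (((2 : ℝ) ^ (1 / 4 : ℝ) * Real.exp (-Real.pi * t ^ 2) : ℝ) : ℂ) *
        Complex.exp (-Real.pi * (x : ℂ) ^ 2 +
          (2 * Real.pi * t - 2 * Real.pi * Complex.I * ν) * x) := by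
  funext x
  unfold tfGaussian
  rw [map_mul, Complex.conj_ofReal, ← Complex.exp_conj]
  push_cast
  simp only [map_mul, Complex.conj_ofReal, Complex.conj_I, map_ofNat]
  rw [mul_left_comm, mul_assoc (((2 : ℝ) ^ (1 / 4 : ℝ) : ℝ) : ℂ), ← Complex.exp_add,
    ← Complex.exp_add]
  congr 2
  ring

/-- The complex conjugate of `π(t,ν) 𝔤` as a Schwartz function. -/
noncomputable def conjTFGaussian (t ν : ℝ) : 𝓢(ℝ, ℂ) where
  toFun x := (starRingEnd ℂ) (tfGaussian t ν x)
  smooth' := by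
    rw [conj_tfGaussian_eq]
    have : ContDiff ℝ (⊤ : ℕ∞) (fun x : ℝ => (x : ℂ)) := Complex.ofRealCLM.contDiff
    fun_prop
  decay' k n := by
    rw [conj_tfGaussian_eq]
    exact gaussian_form_decay _ _ k n

/-- The short-time Fourier transform of a tempered distribution with Gaussian window,
`V f (t, ν) = ⟨f, π(t,ν) 𝔤⟩`; the pairing `⟨·,·⟩` is antilinear in its second argument. -/
noncomputable def gaussianSTFT (f : 𝓢'(ℝ, ℂ)) (z : ℝ × ℝ) : ℂ :=
  f (conjTFGaussian z.1 z.2)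

/-- The modulation space `M^{1,1}(ℝ)` (the Feichtinger algebra): tempered distributions whose
short-time Fourier transform is integrable on `ℝ²`. -/
def modulationSpaceOneOne : Set 𝓢'(ℝ, ℂ) :=
  {f | Integrable (gaussianSTFT f) (volume : Measure (ℝ × ℝ))}

/-- The Paley-Wiener type condition `supp m̂ ⊆ [-Ω/2, Ω/2)` for `m ∈ L^p(ℝ)`: Fourier transform
and support are those of tempered distributions. -/
def IsBandlimited {p : ℝ≥0∞} [Fact (1 ≤ p)] (Ω : ℝ) (m : Lp ℂ p (volume : Measure ℝ)) : Prop :=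
  Distribution.dsupport (𝓕 (m : 𝓢'(ℝ, ℂ)) : 𝓢'(ℝ, ℂ)) ⊆ Set.Ico (-Ω / 2) (Ω / 2)

/-- `s` is (the continuous representative of) an element of `M^{1,1}(ℝ)` with
`supp ŝ ⊆ [-1/(2T), 1/(2T))` and `ŝ ≡ T` on `[-Ω/2, Ω/2)`. Every element of `M^{1,1}(ℝ)` is given
by a continuous integrable function, so that `ŝ` is the Fourier integral of `s`. -/
structure IsSamplingKernel (T Ω : ℝ) (s : ℝ → ℂ) : Prop where
  continuous : Continuous s
  memLp : MemLp s 1 (volume : Measure ℝ)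
  mem_modulationSpace : ((memLp.toLp s : Lp ℂ 1 (volume : Measure ℝ)) : 𝓢'(ℝ, ℂ)) ∈
    modulationSpaceOneOne
  tsupport_fourier : tsupport (𝓕 s) ⊆ Set.Ico (-1 / (2 * T)) (1 / (2 * T))
  fourier_eq : ∀ ξ ∈ Set.Ico (-Ω / 2) (Ω / 2), 𝓕 s ξ = (T : ℂ)

/-! Sampling is governed by convolution. If `φ` is Schwartz with `φ̂ = 1` on a neighbourhood of the
band, then `m = m ∗ φ`: the distribution `m̂` kills `(1 - φ̂)ψ` because the supports are disjoint
(`ae_eq_integral_mul_schwartz`). The convolution is continuous and bounded, which supplies the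
representative and writes its samples as integrals against `φ`. Associativity, followed by a
dilation limit, extends this to `m ∗ h = c m` for every integrable `h` with `ĥ = c` on the closed
band (`IsReproducedOn.integral_mul_eq_of_Icc`).

For fixed `x`, Poisson summation is applied to `y ↦ m(Ty) s(x - Ty)`. Up to a factor, its `n`-th
Fourier coefficient is the convolution of `m` with a modulate of `s`, whose transform is `ŝ` shifted
by `n/T`. On the band this equals `T` for `n = 0`; for `n ≠ 0` it vanishes near the band since `TΩ <
1`. Hence the series sums to `m(x)` (`IsSamplingKernel.hasSum`).

The estimates rest on the embedding of `M^{1,1}` into the Wiener amalgam space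
(`exists_summable_bound_of_mem_modulationSpace`). It bounds `∑ₖ |s(x - kT)|` uniformly in `x`;
together with `‖s‖₁` these are the marginals of a kernel between `ℝ` and `ℤ`. Schur's test
(`eLpNorm_lintegral_kernel_le`) then bounds sampling and synthesis for all `p`. Synthesis with one
fixed kernel gives the lower norm bound, synthesis of the tails gives `L^p` convergence, and
dominated convergence gives the weak-* statement. -/

/-! ### Schur's test and weighted integrability. -/

/-- Jensen's inequality for a measure of total mass at most `C` with density `k`. -/
theorem lintegral_mul_rpow_le {Y : Type*} [MeasurableSpace Y] {ν : Measure Y} {q : ℝ} (hq : 1 ≤ q)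
    {k f : Y → ℝ≥0∞} {C : ℝ≥0∞} (hk : Measurable k) (hf : Measurable f) (hC : ∫⁻ y, k y ∂ν ≤ C) :
    (∫⁻ y, k y * f y ∂ν) ^ q ≤ C ^ (q - 1) * ∫⁻ y, k y * f y ^ q ∂ν := by
  have hq0 : 0 < q := by linarith
  -- Jensen is the comparison of the `L^1` and `L^q` norms for the measure with density `k`; the
  -- mass enters to the power `1 - 1/q`, hence `q - 1` after raising to `q`.
  have h := eLpNorm'_le_eLpNorm'_mul_rpow_measure_univ (μ := ν.withDensity k) (f := f)
    one_pos hq hf.aestronglyMeasurable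
  simp only [eLpNorm', enorm_eq_self, ENNReal.rpow_one, div_one, one_div] at h
  rw [lintegral_withDensity_eq_lintegral_mul _ hk hf,
    lintegral_withDensity_eq_lintegral_mul _ hk (hf.pow_const q), withDensity_apply _ .univ,
    Measure.restrict_univ] at h
  simp only [Pi.mul_apply] at h
  calc (∫⁻ y, k y * f y ∂ν) ^ q
      ≤ ((∫⁻ y, k y * f y ^ q ∂ν) ^ q⁻¹ * (∫⁻ y, k y ∂ν) ^ (1 - q⁻¹)) ^ q := by gcongr
    _ = (∫⁻ y, k y ∂ν) ^ (q - 1) * ∫⁻ y, k y * f y ^ q ∂ν := by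
        rw [ENNReal.mul_rpow_of_nonneg _ _ hq0.le, ← ENNReal.rpow_mul, ← ENNReal.rpow_mul,
          inv_mul_cancel₀ hq0.ne', ENNReal.rpow_one, sub_mul, inv_mul_cancel₀ hq0.ne', one_mul,
          mul_comm]
    _ ≤ _ := by
        gcongr

/-- Schur's test: a positive kernel whose marginals are bounded by `C` maps `L^p` to `L^p` with
norm at most `C`. -/
theorem eLpNorm_lintegral_kernel_le {X Y : Type*} [MeasurableSpace X] [MeasurableSpace Y]
    {μ : Measure X} {ν : Measure Y} [SFinite μ] [SFinite ν] {p : ℝ≥0∞} (hp : 1 ≤ p)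
    {K : X → Y → ℝ≥0∞} {f : Y → ℝ≥0∞} {C : ℝ≥0∞} (hK : Measurable (Function.uncurry K))
    (hf : Measurable f) (h1 : ∀ x, ∫⁻ y, K x y ∂ν ≤ C) (h2 : ∀ y, ∫⁻ x, K x y ∂μ ≤ C) :
    eLpNorm (fun x => ∫⁻ y, K x y * f y ∂ν) p μ ≤ C * eLpNorm f p ν := by
  have hKx : ∀ x, Measurable (K x) := fun x => hK.comp measurable_prodMk_left
  have hKy : ∀ y, Measurable fun x => K x y := fun y => hK.comp measurable_prodMk_right
  rcases eq_or_ne p ∞ with rfl | hpt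
  · simp only [eLpNorm_exponent_top, eLpNormEssSup, enorm_eq_self]
    refine essSup_le_of_ae_le _ (Filter.Eventually.of_forall fun x => ?_)
    calc ∫⁻ y, K x y * f y ∂ν ≤ ∫⁻ y, K x y * essSup f ν ∂ν := by
          refine lintegral_mono_ae ?_
          filter_upwards [ENNReal.ae_le_essSup f] with y hy
          exact mul_le_mul_right hy _
      _ = (∫⁻ y, K x y ∂ν) * essSup f ν := lintegral_mul_const _ (hKx x)
      _ ≤ _ := mul_le_mul_left (h1 x) _
  · have hp0 : p ≠ 0 := (zero_lt_one.trans_le hp).ne'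
    have hq : 1 ≤ p.toReal := by
      rw [← ENNReal.toReal_one]; exact ENNReal.toReal_mono hpt hp
    have hq0 : 0 < p.toReal := by linarith
    rw [eLpNorm_eq_lintegral_rpow_enorm_toReal hp0 hpt, eLpNorm_eq_lintegral_rpow_enorm_toReal hp0 hpt]
    simp only [enorm_eq_self]
    rw [one_div, ENNReal.rpow_inv_le_iff hq0, ENNReal.mul_rpow_of_nonneg _ _ hq0.le,
      ← ENNReal.rpow_mul, inv_mul_cancel₀ hq0.ne', ENNReal.rpow_one]
    have hm : Measurable (Function.uncurry fun x y => K x y * f y ^ p.toReal) :=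
      hK.mul ((hf.pow_const _).comp measurable_snd)
    calc ∫⁻ x, (∫⁻ y, K x y * f y ∂ν) ^ p.toReal ∂μ
        ≤ ∫⁻ x, C ^ (p.toReal - 1) * ∫⁻ y, K x y * f y ^ p.toReal ∂ν ∂μ :=
          lintegral_mono fun x => lintegral_mul_rpow_le hq (hKx x) hf (h1 x)
      _ = C ^ (p.toReal - 1) * ∫⁻ y, (∫⁻ x, K x y ∂μ) * f y ^ p.toReal ∂ν := by
          rw [lintegral_const_mul _ hm.lintegral_prod_right, lintegral_lintegral_swap hm.aemeasurable]
          simp_rw [lintegral_mul_const _ (hKy _)]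
      _ ≤ C ^ (p.toReal - 1) * ∫⁻ y, C * f y ^ p.toReal ∂ν := by
          gcongr with y; exact h2 y
      _ = C ^ p.toReal * ∫⁻ y, f y ^ p.toReal ∂ν := by
          rw [lintegral_const_mul _ (hf.pow_const _), ← mul_assoc]
          congr 1
          nth_rw 2 [← ENNReal.rpow_one C]
          rw [← ENNReal.rpow_add_of_nonneg _ _ (by linarith) one_pos.le, sub_add_cancel]

/-- `(1 + x ^ 2)⁻¹` belongs to every `L^q(ℝ)`. -/
theorem memLp_inv_one_add_sq {q : ℝ≥0∞} (hq : 1 ≤ q) :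
    MemLp (fun x : ℝ => (1 + x ^ 2)⁻¹) q volume := by
  have h1 : MemLp (fun x : ℝ => (1 + x ^ 2)⁻¹) 1 volume :=
    memLp_one_iff_integrable.2 integrable_inv_one_add_sq
  have h2 : MemLp (fun x : ℝ => (1 + x ^ 2)⁻¹) ∞ volume :=
    memLp_top_of_bound h1.aestronglyMeasurable 1 (Filter.Eventually.of_forall fun x => by
      rw [Real.norm_of_nonneg (by positivity)]
      exact inv_le_one_of_one_le₀ (by nlinarith [sq_nonneg x]))
  rcases eq_or_ne q ∞ with rfl | hqt
  · exact h2
  have hq0 : q ≠ 0 := (zero_lt_one.trans_le hq).ne'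
  have hq1 : 1 ≤ q.toReal := by
    rw [← ENNReal.toReal_one]; exact ENNReal.toReal_mono hqt hq
  rw [← integrable_norm_rpow_iff h1.aestronglyMeasurable hq0 hqt]
  refine integrable_inv_one_add_sq.mono' 
    (h1.aestronglyMeasurable.norm.aemeasurable.pow_const _).aestronglyMeasurable
    (Filter.Eventually.of_forall fun x => ?_)
  have hx : 0 ≤ (1 + x ^ 2)⁻¹ := by positivity
  rw [Real.norm_of_nonneg (by positivity), Real.norm_of_nonneg hx]
  exact Real.rpow_le_self_of_le_one hx (inv_le_one_of_one_le₀ (by nlinarith [sq_nonneg x])) hq1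

/-- Functions in `L^p(ℝ)` are integrable against the weight `(1 + x ^ 2)⁻¹`. -/
theorem MeasureTheory.MemLp.integrable_mul_inv_one_add_sq {p : ℝ≥0∞} (hp : 1 ≤ p) {f : ℝ → ℂ}
    (hf : MemLp f p volume) : Integrable (fun x => ‖f x‖ * (1 + x ^ 2)⁻¹) volume := by
  have : Fact (1 ≤ p) := ⟨hp⟩
  -- The exponent `(1 - p⁻¹)⁻¹` is conjugate to `p`, endpoints `1` and `∞` included.
  have := ENNReal.HolderConjugate.inv_one_sub_inv' hp
  have h : (1 : ℝ≥0∞) ≤ (1 - p⁻¹)⁻¹ := by simp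
  have := (memLp_inv_one_add_sq h).mul (r := 1) hf.norm
  exact memLp_one_iff_integrable.1 this

/-! ### Amalgam bounds for the Feichtinger algebra. -/

/-- The normalized Gaussian on the real line. -/
noncomputable def realGaussian (x : ℝ) : ℝ := (2 : ℝ) ^ (1 / 4 : ℝ) * Real.exp (-Real.pi * x ^ 2)

theorem continuous_realGaussian : Continuous realGaussian := by
  unfold realGaussian; fun_prop

theorem realGaussian_pos (x : ℝ) : 0 < realGaussian x := by
  unfold realGaussian; positivity

theorem realGaussian_le (x : ℝ) : realGaussian x ≤ (2 : ℝ) ^ (1 / 4 : ℝ) := by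
  refine mul_le_of_le_one_right (by positivity) (Real.exp_le_one_iff.2 ?_)
  nlinarith [Real.pi_pos, mul_nonneg Real.pi_pos.le (sq_nonneg x)]

theorem realGaussian_le_of_abs_le {x y : ℝ} (h : |x| ≤ y) : realGaussian y ≤ realGaussian x := by
  unfold realGaussian
  have : x ^ 2 ≤ y ^ 2 := sq_le_sq' (by linarith [neg_abs_le x]) (by linarith [le_abs_self x])
  gcongr ?_ * Real.exp ?_
  nlinarith [Real.pi_pos]

theorem conj_tfGaussian (t ν x : ℝ) : (starRingEnd ℂ) (tfGaussian t ν x) =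
    Complex.exp ((-2 * Real.pi * x * ν : ℝ) * Complex.I) * (realGaussian (x - t) : ℂ) := by
  unfold tfGaussian realGaussian
  rw [map_mul, Complex.conj_ofReal, ← Complex.exp_conj]
  simp only [map_mul, Complex.conj_ofReal, Complex.conj_I, map_ofNat]
  congr 2
  push_cast
  ring

/-- For fixed `t`, the short-time Fourier transform of a function is the Fourier integral of the
function multiplied by a translated Gaussian. -/
theorem gaussianSTFT_toLp {s : ℝ → ℂ} (hs : MemLp s 1 (volume : Measure ℝ)) (t ν : ℝ) :
    gaussianSTFT ((hs.toLp s : Lp ℂ 1 (volume : Measure ℝ)) : 𝓢'(ℝ, ℂ)) (t, ν) =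
      𝓕 (fun y : ℝ => s y * (realGaussian (y - t) : ℂ)) ν := by
  unfold gaussianSTFT
  rw [Lp.toTemperedDistribution_apply, Real.fourier_real_eq_integral_exp_smul]
  refine integral_congr_ae ?_
  filter_upwards [hs.coeFn_toLp] with y hy
  rw [hy]
  change (starRingEnd ℂ) (tfGaussian t ν y) • s y = _
  rw [conj_tfGaussian]
  simp only [smul_eq_mul]
  ring

theorem integrable_mul_realGaussian {s : ℝ → ℂ} (hs : Integrable s volume) (t : ℝ) :
    Integrable (fun y : ℝ => s y * (realGaussian (y - t) : ℂ)) volume := by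
  refine hs.mul_bdd (c := (2 : ℝ) ^ (1 / 4 : ℝ)) ?_ (Filter.Eventually.of_forall fun y => ?_)
  · exact (Complex.continuous_ofReal.comp (continuous_realGaussian.comp
      (continuous_id.sub continuous_const))).aestronglyMeasurable
  · rw [Complex.norm_real, Real.norm_of_nonneg (realGaussian_pos _).le]
    exact realGaussian_le _

/-- Continuous functions in the Feichtinger algebra lie in the Wiener amalgam space
`W(C, ℓ^1)`: their local suprema along a lattice are summable. -/
theorem exists_summable_bound_of_mem_modulationSpace {s : ℝ → ℂ} (hc : Continuous s)
    (hs : MemLp s 1 (volume : Measure ℝ))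
    (hmod : ((hs.toLp s : Lp ℂ 1 (volume : Measure ℝ)) : 𝓢'(ℝ, ℂ)) ∈ modulationSpaceOneOne)
    {T : ℝ} (hT : 0 < T) (R : ℝ) :
    ∃ b : ℤ → ℝ, Summable b ∧ ∀ (k : ℤ) (z : ℝ), |z - k * T| ≤ R → ‖s z‖ ≤ b k := by
  have hsi : Integrable s volume := memLp_one_iff_integrable.1 hs
  set V := gaussianSTFT ((hs.toLp s : Lp ℂ 1 (volume : Measure ℝ)) : 𝓢'(ℝ, ℂ)) with hV
  have hVi : Integrable V ((volume : Measure ℝ).prod volume) := hmod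
  set H : ℝ → ℝ := fun t => ∫ ν, ‖V (t, ν)‖ with hH
  have hHi : Integrable H volume := hVi.integral_norm_prod_left
  -- For almost every `t` the slice `V(t, ·)` is integrable and is the Fourier transform of `s · 𝔤(·
  -- - t)`; inversion bounds that product by the `L^1` norm of the slice.
  have hbound : ∀ᵐ t : ℝ, ∀ x : ℝ, ‖s x‖ * realGaussian (x - t) ≤ H t := by
    filter_upwards [hVi.prod_right_ae] with t ht x
    have hF : (fun ν => V (t, ν)) = 𝓕 (fun y : ℝ => s y * (realGaussian (y - t) : ℂ)) :=
      funext fun ν => gaussianSTFT_toLp hs t ν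
    have hcont : Continuous (fun y : ℝ => s y * (realGaussian (y - t) : ℂ)) :=
      hc.mul (Complex.continuous_ofReal.comp (continuous_realGaussian.comp
        (continuous_id.sub continuous_const)))
    have hinv := congrFun (hcont.fourierInv_fourier_eq (integrable_mul_realGaussian hsi t)
      (hF ▸ ht)) x
    calc ‖s x‖ * realGaussian (x - t) = ‖s x * (realGaussian (x - t) : ℂ)‖ := by
          rw [norm_mul, Complex.norm_real, Real.norm_of_nonneg (realGaussian_pos _).le]
      _ ≤ H t := by
          rw [← hinv, Real.fourierInv_eq, ← hF]
          refine (norm_integral_le_integral_norm _).trans_eq ?_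
          simp only [Circle.norm_smul, hH]
  -- For `t` in the cell `(kT, (k+1)T]` and `|z - kT| ≤ R` one has `|z - t| ≤ R + T`, so the
  -- Gaussian factor is at least `c`. Averaging over the cell gives the bound, and the cells are
  -- disjoint, so these averages are summable.
  set c := realGaussian (R + T) with hcdef
  have hc0 : 0 < c := realGaussian_pos _
  refine ⟨fun k => (T * c)⁻¹ * ∫ t in Set.Ioc (k • T) ((k + 1) • T), H t, ?_, fun k z hz => ?_⟩
  · refine Summable.mul_left _ (HasSum.summable (hasSum_integral_iUnion
      (fun k => measurableSet_Ioc) (Set.pairwise_disjoint_Ioc_zsmul T) hHi.integrableOn))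
  · have h1 : ∀ᵐ t ∂(volume.restrict (Set.Ioc (k • T) ((k + 1) • T))), ‖s z‖ * c ≤ H t := by
      filter_upwards [ae_restrict_mem measurableSet_Ioc, ae_restrict_of_ae hbound] with t ht hb
      refine le_trans ?_ (hb z)
      refine mul_le_mul_of_nonneg_left (realGaussian_le_of_abs_le ?_) (norm_nonneg _)
      rw [Set.mem_Ioc, zsmul_eq_mul, zsmul_eq_mul] at ht
      push_cast at ht
      rw [abs_le] at hz ⊢
      constructor <;> nlinarith
    have h2 := integral_mono_ae (μ := volume.restrict (Set.Ioc (k • T) ((k + 1) • T)))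
      (integrable_const _) hHi.integrableOn h1
    rw [integral_const, measureReal_restrict_apply_univ, Real.volume_real_Ioc_of_le, zsmul_eq_mul,
      zsmul_eq_mul, smul_eq_mul] at h2
    · push_cast at h2
      rw [le_inv_mul_iff₀ (by positivity)]
      simp only [zsmul_eq_mul]
      push_cast
      linarith
    · rw [zsmul_eq_mul, zsmul_eq_mul]; push_cast; nlinarith

/-- The sums `∑ₖ ‖s (x - kT)‖` are bounded uniformly in `x`. -/
theorem exists_summable_bound_sub {s : ℝ → ℂ} {T : ℝ} (hT : 0 < T)
    (h : ∀ R : ℝ, ∃ b : ℤ → ℝ, Summable b ∧ ∀ (k : ℤ) (z : ℝ), |z - k * T| ≤ R → ‖s z‖ ≤ b k) :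
    ∃ C : ℝ, ∀ x : ℝ, (Summable fun k : ℤ => ‖s (x - k * T)‖) ∧ ∑' k : ℤ, ‖s (x - k * T)‖ ≤ C := by
  -- Radius `T` suffices: `x - kT` lies within `T` of the lattice point of index `⌊x/T⌋ - k`.
  obtain ⟨b, hb, hbs⟩ := h T
  refine ⟨∑' k, b k, fun x => ?_⟩
  have hle : ∀ k : ℤ, ‖s (x - k * T)‖ ≤ b (⌊x / T⌋ - k) := fun k => by
    refine hbs _ _ ?_
    have h1 := Int.floor_le (x / T)
    have h2 := Int.lt_floor_add_one (x / T)
    rw [le_div_iff₀ hT] at h1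
    rw [div_lt_iff₀ hT] at h2
    push_cast
    rw [abs_le]
    constructor <;> nlinarith
  have hb' : Summable fun k : ℤ => b (⌊x / T⌋ - k) := (Equiv.subLeft ⌊x / T⌋).summable_iff.2 hb
  have hsum : Summable fun k : ℤ => ‖s (x - k * T)‖ :=
    hb'.of_nonneg_of_le (fun _ => norm_nonneg _) hle
  exact ⟨hsum, (hsum.tsum_le_tsum hle hb').trans_eq ((Equiv.subLeft ⌊x / T⌋).tsum_eq b)⟩

/-! ### Identities and uniqueness for the Fourier integral. -/

/-- The Fourier integral is self-adjoint. -/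
theorem integral_fourier_mul_eq_flip {f g : ℝ → ℂ} (hf : Integrable f volume)
    (hg : Integrable g volume) : ∫ x, 𝓕 f x * g x = ∫ x, f x * 𝓕 g x := by
  have h := VectorFourier.integral_fourierIntegral_smul_eq_flip (L := innerₗ ℝ)
    Real.continuous_fourierChar continuous_inner hf hg
  rw [flip_innerₗ] at h
  exact h

/-- Modulation becomes translation under the Fourier integral. -/
theorem fourier_modulation (g : ℝ → ℂ) (u x : ℝ) :
    𝓕 (fun ξ : ℝ => Complex.exp ((2 * Real.pi * u * ξ : ℝ) * Complex.I) * g ξ) x =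
      𝓕 g (x - u) := by
  rw [Real.fourier_real_eq_integral_exp_smul, Real.fourier_real_eq_integral_exp_smul]
  refine integral_congr_ae (Filter.Eventually.of_forall fun v => ?_)
  simp only [smul_eq_mul]
  rw [← mul_assoc, ← Complex.exp_add]
  congr 2
  push_cast
  ring

/-- Translation becomes modulation under the Fourier integral. -/
theorem fourier_translation (g : ℝ → ℂ) (c x : ℝ) :
    𝓕 (fun ξ : ℝ => g (ξ - c)) x =
      Complex.exp ((-2 * Real.pi * c * x : ℝ) * Complex.I) * 𝓕 g x := by
  rw [Real.fourier_real_eq_integral_exp_smul, Real.fourier_real_eq_integral_exp_smul,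
    ← integral_const_mul, ← integral_add_right_eq_self _ c]
  refine integral_congr_ae (Filter.Eventually.of_forall fun v => ?_)
  simp only [smul_eq_mul, add_sub_cancel_right]
  rw [← mul_assoc, ← Complex.exp_add]
  congr 2
  push_cast
  ring

theorem continuous_modulation (u : ℝ) :
    Continuous fun ξ : ℝ => Complex.exp ((2 * Real.pi * u * ξ : ℝ) * Complex.I) := by
  fun_prop

theorem contDiff_modulation (u : ℝ) {n : WithTop ℕ∞} :
    ContDiff ℝ n fun ξ : ℝ => Complex.exp ((2 * Real.pi * u * ξ : ℝ) * Complex.I) := by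
  have : ContDiff ℝ n fun ξ : ℝ => ((2 * Real.pi * u * ξ : ℝ) : ℂ) :=
    Complex.ofRealCLM.contDiff.comp (contDiff_const.mul contDiff_id)
  fun_prop

theorem integrable_modulation_mul {g : ℝ → ℂ} (hg : Integrable g volume) (u : ℝ) :
    Integrable (fun ξ : ℝ => Complex.exp ((2 * Real.pi * u * ξ : ℝ) * Complex.I) * g ξ) volume :=
  hg.bdd_mul (c := 1) (continuous_modulation u).aestronglyMeasurable
    (Filter.Eventually.of_forall fun _ => (Complex.norm_exp_ofReal_mul_I _).le)

/-- An integrable function with vanishing Fourier integral vanishes almost everywhere. -/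
theorem ae_eq_zero_of_fourier_eq_zero {f : ℝ → ℂ} (hf : Integrable f volume)
    (h : ∀ ξ, 𝓕 f ξ = 0) : f =ᵐ[volume] 0 := by
  refine ae_eq_zero_of_integral_contDiff_smul_eq_zero hf.locallyIntegrable fun g hg hgc => ?_
  have hc : HasCompactSupport (Complex.ofRealCLM ∘ g) := hgc.comp_left rfl
  set G : 𝓢(ℝ, ℂ) := hc.toSchwartzMap (Complex.ofRealCLM.contDiff.comp hg)
  have hG : ∀ x, G x = (g x : ℂ) := fun x => by simp [G]
  calc ∫ x, g x • f x = ∫ x, f x * 𝓕 (𝓕⁻ G : 𝓢(ℝ, ℂ)) x := by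
        refine integral_congr_ae (Filter.Eventually.of_forall fun x => ?_)
        simp only [FourierTransform.fourier_fourierInv_eq, hG, Complex.real_smul, mul_comm]
    _ = ∫ x, 𝓕 f x * (𝓕⁻ G : 𝓢(ℝ, ℂ)) x := by
        rw [integral_fourier_mul_eq_flip hf (SchwartzMap.integrable _)]
        rfl
    _ = 0 := by simp [h]

/-- The Fourier transform of a product of Schwartz functions is a convolution. -/
theorem fourier_mul_eq_integral (φ : 𝓢(ℝ, ℂ)) (ψ : ℝ → ℂ) (hψ : Integrable ψ volume) (x : ℝ) :
    𝓕 (fun ξ => 𝓕 (φ : ℝ → ℂ) ξ * ψ ξ) x = ∫ y, φ (y - x) * 𝓕 ψ y := by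
  have h1 : 𝓕 (fun ξ => 𝓕 (φ : ℝ → ℂ) ξ * ψ ξ) x = ∫ ξ, 𝓕 (φ : ℝ → ℂ) ξ *
      (Complex.exp ((2 * Real.pi * (-x) * ξ : ℝ) * Complex.I) * ψ ξ) := by
    rw [Real.fourier_real_eq_integral_exp_smul]
    refine integral_congr_ae (Filter.Eventually.of_forall fun v => ?_)
    simp only [smul_eq_mul]
    rw [mul_left_comm]
    congr 4
    push_cast
    ring
  rw [h1, integral_fourier_mul_eq_flip φ.integrable (integrable_modulation_mul hψ _),
    ← integral_sub_right_eq_self _ x]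
  refine integral_congr_ae (Filter.Eventually.of_forall fun v => ?_)
  simp only
  rw [fourier_modulation, sub_neg_eq_add, sub_add_cancel]

/-! ### Cutoffs and supports of tempered distributions. -/

/-- A Schwartz function that is `1` on `[-a', a']` for some `a' > a` and supported
in `(-b, b)`. -/
theorem exists_schwartz_bump {a b : ℝ} (ha : 0 < a) (hab : a < b) :
    ∃ Φ : 𝓢(ℝ, ℂ), tsupport Φ ⊆ Set.Ioo (-b) b ∧ ∃ a' > a, ∀ ξ, |ξ| ≤ a' → Φ ξ = 1 := by
  let f : ContDiffBump (0 : ℝ) :=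
    ⟨(2 * a + b) / 3, (a + 2 * b) / 3, by linarith, by linarith⟩
  have hc : HasCompactSupport (Complex.ofRealCLM ∘ f) := f.hasCompactSupport.comp_left rfl
  refine ⟨hc.toSchwartzMap (Complex.ofRealCLM.contDiff.comp f.contDiff), ?_,
    (2 * a + b) / 3, by linarith, fun ξ hξ => ?_⟩
  · refine (tsupport_comp_subset (g := Complex.ofRealCLM) (by simp) f).trans ?_
    rw [f.tsupport_eq, Real.closedBall_eq_Icc]
    refine Set.Icc_subset_Ioo ?_ ?_ <;> simp only [f] <;> linarith
  · have : f ξ = 1 := f.one_of_mem_closedBall (by simpa [f] using hξ)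
    simp [this]

/-- A tempered distribution annihilates compactly supported test functions whose support does
not meet its own. -/
theorem apply_eq_zero_of_disjoint_dsupport (f : 𝓢'(ℝ, ℂ)) (χ : 𝓢(ℝ, ℂ))
    (hχ : HasCompactSupport χ) (hd : Disjoint (tsupport χ) (Distribution.dsupport f)) :
    f χ = 0 := by
  have hU : ∀ x : tsupport χ, ∃ U : Set ℝ, Distribution.IsVanishingOn f U ∧ IsOpen U ∧ (x : ℝ) ∈ U :=
    fun x => (Distribution.notMem_dsupport_iff _).1 (Set.disjoint_left.1 hd x.2)
  choose U hUv hUo hUx using hU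
  obtain ⟨t, ht⟩ := hχ.elim_finite_subcover U hUo
    fun x hx => Set.mem_iUnion.2 ⟨⟨x, hx⟩, hUx ⟨x, hx⟩⟩
  -- A partition of unity subordinate to the finite cover splits `χ` into test functions, each
  -- supported where `f` vanishes.
  obtain ⟨ρ, hρ⟩ := SmoothPartitionOfUnity.exists_isSubordinate (modelWithCornersSelf ℝ ℝ)
    (isClosed_tsupport χ) (fun i : t => U i) (fun i => hUo i)
    (by simpa only [Set.iUnion_subtype] using ht)
  have hc : ∀ i : t, HasCompactSupport fun x => (ρ i x : ℂ) * χ x := fun i => hχ.mul_left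
  have hs : ∀ i : t, ContDiff ℝ (⊤ : ℕ∞) fun x => (ρ i x : ℂ) * χ x := fun i =>
    (Complex.ofRealCLM.contDiff.comp (ρ i).contMDiff.contDiff).mul (χ.smooth _)
  have hsum : χ = ∑ i : t, (hc i).toSchwartzMap (hs i) := by
    ext x
    rw [sum_apply]
    simp only [HasCompactSupport.toSchwartzMap_toFun]
    rw [← Finset.sum_mul]
    by_cases hx : x ∈ tsupport χ
    · have := ρ.sum_eq_one hx
      rw [finsum_eq_sum_of_fintype] at this
      rw [← Complex.ofReal_sum, this, Complex.ofReal_one, one_mul]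
    · rw [image_eq_zero_of_notMem_tsupport hx, mul_zero]
  rw [hsum, map_sum]
  refine Finset.sum_eq_zero fun i _ => hUv i _ ?_
  refine (closure_mono ?_).trans (hρ i)
  intro x hx
  have : (ρ i x : ℂ) * χ x ≠ 0 := hx
  exact fun h0 => this (by simp [h0])

/-! ### Convolution of `L^p` functions with Schwartz functions. -/

theorem SchwartzMap.exists_norm_le_inv_one_add_sq (φ : 𝓢(ℝ, ℂ)) :
    ∃ C : ℝ, 0 ≤ C ∧ ∀ x, ‖φ x‖ ≤ C * (1 + x ^ 2)⁻¹ := by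
  refine ⟨SchwartzMap.seminorm ℝ 0 0 φ + SchwartzMap.seminorm ℝ 2 0 φ,
    add_nonneg (apply_nonneg _ _) (apply_nonneg _ _), fun x => ?_⟩
  rw [← div_eq_mul_inv, le_div_iff₀ (by positivity), mul_add, mul_one]
  have h2 := SchwartzMap.norm_pow_mul_le_seminorm ℝ φ 2 x
  rw [Real.norm_eq_abs, sq_abs] at h2
  have h1 := SchwartzMap.norm_le_seminorm ℝ φ x
  linarith

/-- Peetre's inequality. -/
theorem one_add_sq_le (x y : ℝ) : 1 + x ^ 2 ≤ 2 * (1 + (y - x) ^ 2) * (1 + y ^ 2) := by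
  nlinarith [sq_nonneg (2 * y - x), mul_nonneg (sq_nonneg (y - x)) (sq_nonneg y)]

theorem inv_one_add_sq_mul_le (x y : ℝ) :
    (1 + (y - x) ^ 2)⁻¹ * (1 + y ^ 2)⁻¹ ≤ 2 * (1 + x ^ 2)⁻¹ := by
  rw [← mul_inv, ← div_eq_mul_inv, le_div_iff₀ (by positivity),
    inv_mul_le_iff₀ (by positivity)]
  linarith [one_add_sq_le x y]

theorem inv_one_add_sq_sub_le (x y : ℝ) :
    (1 + (x - y) ^ 2)⁻¹ ≤ 2 * (1 + x ^ 2) * (1 + y ^ 2)⁻¹ := by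
  rw [← div_eq_mul_inv, le_div_iff₀ (by positivity), inv_mul_le_iff₀ (by positivity)]
  linarith [one_add_sq_le y x]

/-- The products `m(y) φ(x - y)` are dominated uniformly for `x` in bounded sets. -/
theorem norm_mul_schwartz_le {C : ℝ} (hC : 0 ≤ C) {φ : ℝ → ℂ}
    (hφ : ∀ x, ‖φ x‖ ≤ C * (1 + x ^ 2)⁻¹) (m : ℝ → ℂ) (x y : ℝ) :
    ‖m y * φ (x - y)‖ ≤ 2 * C * (1 + x ^ 2) * (‖m y‖ * (1 + y ^ 2)⁻¹) := by
  rw [norm_mul]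
  calc ‖m y‖ * ‖φ (x - y)‖ ≤ ‖m y‖ * (C * (2 * (1 + x ^ 2) * (1 + y ^ 2)⁻¹)) := by
        gcongr
        exact (hφ _).trans (by gcongr; exact inv_one_add_sq_sub_le x y)
    _ = _ := by ring

theorem integrable_mul_schwartz {m : ℝ → ℂ} (hm : AEStronglyMeasurable m volume)
    (hmi : Integrable (fun x => ‖m x‖ * (1 + x ^ 2)⁻¹) volume) (φ : 𝓢(ℝ, ℂ)) (x : ℝ) :
    Integrable (fun y => m y * φ (x - y)) volume := by
  obtain ⟨C, hC, hφ⟩ := φ.exists_norm_le_inv_one_add_sq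
  exact (hmi.const_mul (2 * C * (1 + x ^ 2))).mono'
    (hm.mul (φ.continuous.comp (continuous_const.sub continuous_id)).aestronglyMeasurable)
    (Filter.Eventually.of_forall fun y => norm_mul_schwartz_le hC hφ m x y)

/-- Convolution with a Schwartz function is continuous. -/
theorem continuous_integral_mul_schwartz {m : ℝ → ℂ} (hm : AEStronglyMeasurable m volume)
    (hmi : Integrable (fun x => ‖m x‖ * (1 + x ^ 2)⁻¹) volume) (φ : 𝓢(ℝ, ℂ)) :
    Continuous fun x => ∫ y, m y * φ (x - y) := by
  obtain ⟨C, hC, hφ⟩ := φ.exists_norm_le_inv_one_add_sq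
  refine continuous_iff_continuousAt.2 fun x₀ => ?_
  refine continuousAt_of_dominated
    (bound := fun y => 2 * C * (1 + (|x₀| + 1) ^ 2) * (‖m y‖ * (1 + y ^ 2)⁻¹)) ?_ ?_
    (hmi.const_mul _) ?_
  · exact Filter.Eventually.of_forall fun x => (integrable_mul_schwartz hm hmi φ x).1
  · filter_upwards [Metric.ball_mem_nhds x₀ one_pos] with x hx
    refine Filter.Eventually.of_forall fun y => (norm_mul_schwartz_le hC hφ m x y).trans ?_
    have hx' : |x| ≤ |x₀| + 1 := by
      rw [Metric.mem_ball, Real.dist_eq] at hx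
      linarith [abs_sub_abs_le_abs_sub x x₀]
    have : x ^ 2 ≤ (|x₀| + 1) ^ 2 := by rw [← sq_abs x]; gcongr
    gcongr
  · exact Filter.Eventually.of_forall fun y =>
      (continuous_const.mul (φ.continuous.comp (continuous_id.sub continuous_const))).continuousAt

/-- The convolution of a function in `L^p` with a Schwartz function is bounded. -/
theorem exists_norm_integral_mul_schwartz_le {p : ℝ≥0∞} (hp : 1 ≤ p) {m : ℝ → ℂ}
    (hm : MemLp m p volume) (φ : 𝓢(ℝ, ℂ)) :
    ∃ C : ℝ, ∀ x, ‖∫ y, m y * φ (x - y)‖ ≤ C := by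
  have : Fact (1 ≤ p) := ⟨hp⟩
  have := ENNReal.HolderConjugate.inv_one_sub_inv' hp
  set q := (1 - p⁻¹)⁻¹
  refine ⟨(eLpNorm φ q volume * eLpNorm m p volume).toReal, fun x => ?_⟩
  have hfin : eLpNorm φ q volume * eLpNorm m p volume ≠ ∞ :=
    ENNReal.mul_ne_top (φ.memLp q volume).eLpNorm_ne_top hm.eLpNorm_ne_top
  have hmp : MeasurePreserving (fun y : ℝ => x - y) volume volume :=
    Measure.measurePreserving_sub_left volume x
  have hφx : eLpNorm (fun y => φ (x - y)) q volume = eLpNorm φ q volume :=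
    eLpNorm_comp_measurePreserving φ.continuous.aestronglyMeasurable hmp
  have h1 := eLpNorm_smul_le_mul_eLpNorm (p := p) (q := q) (r := 1) (μ := volume)
    (f := fun y => φ (x - y)) (φ := m)
    (φ.continuous.comp (continuous_const.sub continuous_id)).aestronglyMeasurable hm.1
  rw [hφx, eLpNorm_one_eq_lintegral_enorm, mul_comm] at h1
  rw [← toReal_enorm]
  exact ENNReal.toReal_mono hfin ((enorm_integral_le_lintegral_enorm _).trans h1)

/-! ### Reproduction of bandlimited functions. -/

/-- A function that annihilates the Fourier transforms of all test functions vanishes almost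
everywhere. -/
theorem ae_eq_zero_of_integral_mul_fourier_eq_zero {u : ℝ → ℂ}
    (hu : AEStronglyMeasurable u volume)
    (hui : Integrable (fun x => ‖u x‖ * (1 + x ^ 2)⁻¹) volume)
    (h : ∀ ψ : 𝓢(ℝ, ℂ), HasCompactSupport ψ → ∫ x, u x * 𝓕 (ψ : ℝ → ℂ) x = 0) :
    u =ᵐ[volume] 0 := by
  obtain ⟨Ψ, hΨs, a', ha', hΨ⟩ := exists_schwartz_bump one_pos one_lt_two
  have hΨc : HasCompactSupport Ψ :=
    isCompact_Icc.of_isClosed_subset (isClosed_tsupport Ψ) (hΨs.trans Set.Ioo_subset_Icc_self)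
  -- a test function whose Fourier transform does not vanish near the origin
  obtain ⟨ψ, hψc, hψ0⟩ : ∃ ψ : 𝓢(ℝ, ℂ), HasCompactSupport ψ ∧ (𝓕 ψ : 𝓢(ℝ, ℂ)) 0 ≠ 0 := by
    by_contra! hcon
    -- The value of `Ψ̂` at `ξ` is the value at `0` of the transform of a modulate of `Ψ`, so
    -- failure would force `Ψ̂ = 0`.
    have hz : ∀ ξ, 𝓕 (Ψ : ℝ → ℂ) ξ = 0 := fun ξ => by
      have hc : HasCompactSupport fun x : ℝ =>
        Complex.exp ((2 * Real.pi * (-ξ) * x : ℝ) * Complex.I) * Ψ x := hΨc.mul_left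
      have := hcon (hc.toSchwartzMap ((contDiff_modulation _).mul (Ψ.smooth _))) hc
      rw [SchwartzMap.fourier_coe] at this
      rw [← sub_neg_eq_add 0 ξ |>.trans (zero_add ξ), ← fourier_modulation]
      exact this
    have h0 : Ψ = 0 := by
      have := congrArg (fun z : 𝓢(ℝ, ℂ) => (𝓕⁻ z : 𝓢(ℝ, ℂ)))
        (show (𝓕 Ψ : 𝓢(ℝ, ℂ)) = 0 from SchwartzMap.ext hz)
      have hz0 : (𝓕⁻ (0 : 𝓢(ℝ, ℂ)) : 𝓢(ℝ, ℂ)) = 0 := by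
        ext x
        simp
      simpa only [FourierTransform.fourierInv_fourier_eq, hz0] using this
    have h1 := hΨ 0 (by simpa using (zero_lt_one.trans ha').le)
    rw [h0] at h1
    exact zero_ne_one h1
  set η : 𝓢(ℝ, ℂ) := 𝓕 ψ with hη
  obtain ⟨δ, hδ, hne⟩ := Metric.eventually_nhds_iff.1 (η.continuous.continuousAt.eventually_ne hψ0)
  -- Since `u` need not be integrable, it is localised by translates of `η`. The Fourier integral of
  -- `u η(· - x₀)` at `ξ` is, up to a phase, the pairing of `u` with the transform of a modulated
  -- translate of `ψ`, which is zero.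
  have key : ∀ x₀ : ℝ, (fun x => u x * η (x - x₀)) =ᵐ[volume] 0 := fun x₀ => by
    have hint : Integrable (fun x => u x * η (x - x₀)) volume := by
      obtain ⟨C, hC, hφ⟩ := η.exists_norm_le_inv_one_add_sq
      have := norm_mul_schwartz_le (φ := fun z => η (-z)) hC
        (fun x => by simpa using hφ (-x)) u x₀
      refine (hui.const_mul (2 * C * (1 + x₀ ^ 2))).mono'
        (hu.mul (η.continuous.comp (continuous_id.sub continuous_const)).aestronglyMeasurable)
        (Filter.Eventually.of_forall fun y => ?_)
      simpa using this y
    refine ae_eq_zero_of_fourier_eq_zero hint fun ξ => ?_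
    have hc0 : HasCompactSupport fun x : ℝ => ψ (x - ξ) :=
      hψc.comp_homeomorph (Homeomorph.subRight ξ)
    have hc : HasCompactSupport fun x : ℝ =>
        Complex.exp ((2 * Real.pi * x₀ * x : ℝ) * Complex.I) * ψ (x - ξ) := hc0.mul_left
    have h2 := h (hc.toSchwartzMap ((contDiff_modulation _).mul
      ((ψ.smooth _).comp (contDiff_id.sub contDiff_const)))) hc
    have h3 : ∀ x, 𝓕 (fun x : ℝ =>
        Complex.exp ((2 * Real.pi * x₀ * x : ℝ) * Complex.I) * ψ (x - ξ)) x =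
        Complex.exp ((-2 * Real.pi * ξ * (x - x₀) : ℝ) * Complex.I) * η (x - x₀) := fun x => by
      rw [fourier_modulation (fun z : ℝ => ψ (z - ξ)), fourier_translation]
      rfl
    have h4 : ∫ x, u x * (Complex.exp ((-2 * Real.pi * ξ * (x - x₀) : ℝ) * Complex.I) *
        η (x - x₀)) = 0 := by
      rw [← h2]
      exact integral_congr_ae (Filter.Eventually.of_forall fun x => by simp only [← h3]; rfl)
    rw [Real.fourier_real_eq_integral_exp_smul]
    rw [← mul_zero (Complex.exp ((-2 * Real.pi * ξ * x₀ : ℝ) * Complex.I)), ← h4,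
      ← integral_const_mul]
    refine integral_congr_ae (Filter.Eventually.of_forall fun x => ?_)
    simp only [smul_eq_mul]
    have : Complex.exp ((-2 * Real.pi * x * ξ : ℝ) * Complex.I) =
        Complex.exp ((-2 * Real.pi * ξ * x₀ : ℝ) * Complex.I) *
        Complex.exp ((-2 * Real.pi * ξ * (x - x₀) : ℝ) * Complex.I) := by
      rw [← Complex.exp_add]
      congr 1
      push_cast
      ring
    rw [this]
    ring
  -- Countably many translates, spaced by `δ`, suffice: for each `x` one of them is nonzero at `x`.
  have hall : ∀ᵐ x : ℝ, ∀ n : ℤ, u x * η (x - n * δ) = 0 := ae_all_iff.2 fun n => key (n * δ)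
  filter_upwards [hall] with x hx
  refine (mul_eq_zero.1 (hx ⌊x / δ⌋)).resolve_right (hne ?_)
  have h1 := Int.floor_le (x / δ)
  have h2 := Int.lt_floor_add_one (x / δ)
  rw [le_div_iff₀ hδ] at h1
  rw [div_lt_iff₀ hδ] at h2
  rw [Real.dist_eq, abs_lt]
  constructor <;> nlinarith

/-- The doubled weight lets one factor be spent on Peetre's inequality while the other remains to be
integrated. -/
theorem SchwartzMap.exists_norm_le_inv_one_add_sq_sq (φ : 𝓢(ℝ, ℂ)) :
    ∃ C : ℝ, 0 ≤ C ∧ ∀ x, ‖φ x‖ ≤ C * ((1 + x ^ 2)⁻¹ * (1 + x ^ 2)⁻¹) := by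
  refine ⟨SchwartzMap.seminorm ℝ 0 0 φ + 2 * SchwartzMap.seminorm ℝ 2 0 φ +
    SchwartzMap.seminorm ℝ 4 0 φ, by positivity, fun x => ?_⟩
  rw [← mul_inv, ← div_eq_mul_inv, le_div_iff₀ (by positivity)]
  have h2 := SchwartzMap.norm_pow_mul_le_seminorm ℝ φ 2 x
  have h4 := SchwartzMap.norm_pow_mul_le_seminorm ℝ φ 4 x
  rw [Real.norm_eq_abs, sq_abs] at h2
  rw [Real.norm_eq_abs, show |x| ^ 4 = (x ^ 2) ^ 2 by rw [← sq_abs x]; ring] at h4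
  have h1 := SchwartzMap.norm_le_seminorm ℝ φ x
  linarith

/-- This justifies Fubini when `m` is integrable only against a weight: Peetre's inequality converts
the decay of `φ` and half that of `η` into the weight in the first variable. -/
theorem integrable_prod_mul_schwartz {m : ℝ → ℂ} (hm : AEStronglyMeasurable m volume)
    (hmi : Integrable (fun x => ‖m x‖ * (1 + x ^ 2)⁻¹) volume) (φ η : 𝓢(ℝ, ℂ)) :
    Integrable (fun z : ℝ × ℝ => m z.1 * (φ (z.2 - z.1) * η z.2))
      ((volume : Measure ℝ).prod volume) := by
  obtain ⟨C, hC, hφ⟩ := φ.exists_norm_le_inv_one_add_sq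
  obtain ⟨D, hD, hη⟩ := η.exists_norm_le_inv_one_add_sq_sq
  refine ((hmi.mul_prod integrable_inv_one_add_sq).const_mul (2 * C * D)).mono' ?_
    (Filter.Eventually.of_forall fun z => ?_)
  · refine hm.comp_fst.mul (Continuous.aestronglyMeasurable ?_)
    exact (φ.continuous.comp (continuous_snd.sub continuous_fst)).mul
      (η.continuous.comp continuous_snd)
  · rw [norm_mul, norm_mul]
    calc ‖m z.1‖ * (‖φ (z.2 - z.1)‖ * ‖η z.2‖)
        ≤ ‖m z.1‖ * ((C * (1 + (z.2 - z.1) ^ 2)⁻¹) *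
          (D * ((1 + z.2 ^ 2)⁻¹ * (1 + z.2 ^ 2)⁻¹))) := by
          gcongr
          · exact hφ _
          · exact hη _
      _ = C * D * ‖m z.1‖ * ((1 + (z.2 - z.1) ^ 2)⁻¹ * (1 + z.2 ^ 2)⁻¹) *
          (1 + z.2 ^ 2)⁻¹ := by ring
      _ ≤ C * D * ‖m z.1‖ * (2 * (1 + z.1 ^ 2)⁻¹) * (1 + z.2 ^ 2)⁻¹ := by
          refine mul_le_mul_of_nonneg_right ?_ (by positivity)
          exact mul_le_mul_of_nonneg_left (inv_one_add_sq_mul_le _ _) (by positivity)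
      _ = _ := by ring

/-- A function in `L^p` whose spectrum lies in `[-a, a]` is reproduced by convolution with every
Schwartz function whose Fourier transform is `1` on a neighbourhood of `[-a, a]`. -/
theorem ae_eq_integral_mul_schwartz {p : ℝ≥0∞} [Fact (1 ≤ p)] {a a' : ℝ} (haa' : a < a')
    (m : Lp ℂ p (volume : Measure ℝ))
    (hm : Distribution.dsupport (𝓕 (m : 𝓢'(ℝ, ℂ)) : 𝓢'(ℝ, ℂ)) ⊆ Set.Icc (-a) a)
    (φ : 𝓢(ℝ, ℂ)) (hφ : ∀ ξ, |ξ| ≤ a' → 𝓕 (φ : ℝ → ℂ) ξ = 1) :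
    m =ᵐ[volume] fun x => ∫ y, m y * φ (x - y) := by
  have hmm := Lp.memLp m
  have hmi := hmm.integrable_mul_inv_one_add_sq Fact.out
  have hcont := continuous_integral_mul_schwartz hmm.1 hmi φ
  obtain ⟨B, hB⟩ := exists_norm_integral_mul_schwartz_le Fact.out hmm φ
  set c : ℝ → ℂ := fun x => ∫ y, m y * φ (x - y) with hcdef
  have hci : Integrable (fun x => ‖c x‖ * (1 + x ^ 2)⁻¹) volume :=
    integrable_inv_one_add_sq.bdd_mul (c := B) hcont.norm.aestronglyMeasurable
      (Filter.Eventually.of_forall fun x => by simpa using hB x)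
  suffices h : (fun x => m x - c x) =ᵐ[volume] 0 by
    filter_upwards [h] with x hx
    exact sub_eq_zero.1 hx
  refine ae_eq_zero_of_integral_mul_fourier_eq_zero (hmm.1.sub hcont.aestronglyMeasurable) ?_ ?_
  · refine (hmi.add hci).mono' ?_ (Filter.Eventually.of_forall fun x => ?_)
    · exact (hmm.1.sub hcont.aestronglyMeasurable).norm.mul
        integrable_inv_one_add_sq.aestronglyMeasurable
    · have hx : 0 ≤ (1 + x ^ 2)⁻¹ := by positivity
      rw [Real.norm_of_nonneg (by positivity), Pi.add_apply, ← add_mul]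
      exact mul_le_mul_of_nonneg_right (norm_sub_le _ _) hx
  · intro ψ hψ
    set η : 𝓢(ℝ, ℂ) := 𝓕 ψ with hη
    -- The test function `χ = (1 - φ̂)ψ` vanishes where `|ξ| < a'`, so its support misses `[-a, a]`
    -- and `m̂(χ) = 0`. Unfolded, this reads `∫ m η = ∫ m(x) ∫ φ(y - x) η(y) dy dx`, and Fubini
    -- moves the convolution onto `m`.
    have hc : HasCompactSupport fun ξ => (1 - (𝓕 φ : 𝓢(ℝ, ℂ)) ξ) * ψ ξ := hψ.mul_left
    set χ : 𝓢(ℝ, ℂ) := hc.toSchwartzMap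
      ((contDiff_const.sub ((𝓕 φ : 𝓢(ℝ, ℂ)).smooth _)).mul (ψ.smooth _)) with hχ
    have hχa : ∀ ξ, χ ξ = (1 - (𝓕 φ : 𝓢(ℝ, ℂ)) ξ) * ψ ξ := fun ξ => rfl
    have hχ0 : (𝓕 (m : 𝓢'(ℝ, ℂ)) : 𝓢'(ℝ, ℂ)) χ = 0 := by
      refine apply_eq_zero_of_disjoint_dsupport _ χ hc (Set.disjoint_left.2 fun ξ hξ hξ' => ?_)
      have hsub : tsupport χ ⊆ {ξ | a' ≤ |ξ|} := by
        refine closure_minimal (fun ζ hζ => ?_) (isClosed_le continuous_const continuous_abs)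
        by_contra hlt
        refine hζ ?_
        rw [hχa, SchwartzMap.fourier_coe, hφ ζ (not_le.1 hlt).le, sub_self, zero_mul]
      have h1 : a' ≤ |ξ| := hsub hξ
      have h2 : |ξ| ≤ a := abs_le.2 (hm hξ')
      linarith
    have hFχ : ∀ x, (𝓕 χ : 𝓢(ℝ, ℂ)) x = η x - ∫ y, φ (y - x) * η y := fun x => by
      have hint : Integrable (fun ξ => 𝓕 (φ : ℝ → ℂ) ξ * ψ ξ) volume := by
        have := ψ.integrable (μ := volume) |>.sub χ.integrable
        refine this.congr (Filter.Eventually.of_forall fun ξ => ?_)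
        simp only [Pi.sub_apply, hχa, SchwartzMap.fourier_coe]
        ring
      have h1 : η x - 𝓕 (fun ξ => 𝓕 (φ : ℝ → ℂ) ξ * ψ ξ) x = (𝓕 χ : 𝓢(ℝ, ℂ)) x := by
        rw [hη, SchwartzMap.fourier_coe, SchwartzMap.fourier_coe, Real.fourier_eq,
          Real.fourier_eq, Real.fourier_eq, ← integral_sub]
        · refine integral_congr_ae (Filter.Eventually.of_forall fun ξ => ?_)
          simp only [hχa, SchwartzMap.fourier_coe, sub_mul, one_mul, smul_sub]
        · exact (Real.fourierIntegral_convergent_iff x).2 (ψ.integrable (μ := volume))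
        · exact (Real.fourierIntegral_convergent_iff x).2 hint
      rw [← h1, fourier_mul_eq_integral φ _ ψ.integrable]
      rfl
    rw [TemperedDistribution.fourier_apply, Lp.toTemperedDistribution_apply] at hχ0
    have hprod := integrable_prod_mul_schwartz hmm.1 hmi φ η
    have hmη : Integrable (fun x => m x * η x) volume := by
      simpa using integrable_mul_schwartz hmm.1 hmi
        (SchwartzMap.compCLMOfContinuousLinearEquiv ℝ (ContinuousLinearEquiv.neg ℝ) η) 0
    have hcη : Integrable (fun x => c x * η x) volume :=
      η.integrable.bdd_mul (c := B) hcont.aestronglyMeasurable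
        (Filter.Eventually.of_forall hB)
    have h3 : ∫ x, m x * η x = ∫ x, m x * ∫ y, φ (y - x) * η y := by
      rw [← sub_eq_zero, ← integral_sub hmη, ← hχ0]
      · refine integral_congr_ae (Filter.Eventually.of_forall fun x => ?_)
        simp only [hFχ, smul_eq_mul]
        ring
      · refine hprod.integral_prod_left.congr (Filter.Eventually.of_forall fun x => ?_)
        exact integral_const_mul (m x) fun y => φ (y - x) * η y
    have h4 : ∫ x, m x * ∫ y, φ (y - x) * η y = ∫ y, c y * η y := by
      calc ∫ x, m x * ∫ y, φ (y - x) * η y = ∫ x, ∫ y, m x * (φ (y - x) * η y) := by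
            simp_rw [integral_const_mul]
        _ = ∫ y, ∫ x, m x * (φ (y - x) * η y) := integral_integral_swap hprod
        _ = ∫ y, c y * η y := by
            refine integral_congr_ae (Filter.Eventually.of_forall fun y => ?_)
            simp only [← mul_assoc, hcdef, integral_mul_const]
    simp only [sub_mul]
    rw [← SchwartzMap.fourier_coe, ← hη, integral_sub hmη hcη, h3, h4, sub_self]

/-! ### Passage to integrable kernels. -/

/-- `m` is reproduced by convolution with every Schwartz function whose Fourier transform is `1`
on a neighbourhood of `[-a, a]`. -/
def IsReproducedOn (a : ℝ) (m : ℝ → ℂ) : Prop :=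
  ∀ φ : 𝓢(ℝ, ℂ), (∃ a' > a, ∀ ξ, |ξ| ≤ a' → 𝓕 (φ : ℝ → ℂ) ξ = 1) →
    ∀ x, m x = ∫ y, m y * φ (x - y)

/-- Convolution of an integrable function with a Schwartz function on whose spectrum its Fourier
transform is constant. -/
theorem integral_schwartz_mul_eq {h : ℝ → ℂ} (hh : Integrable h volume) {b : ℝ} {c : ℂ}
    (hc : ∀ ξ, |ξ| ≤ b → 𝓕 h ξ = c) (Φ : 𝓢(ℝ, ℂ)) (hΦ : tsupport Φ ⊆ Set.Ioo (-b) b) (u : ℝ) :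
    ∫ v, h v * (𝓕⁻ Φ : 𝓢(ℝ, ℂ)) (u - v) = c * (𝓕⁻ Φ : 𝓢(ℝ, ℂ)) u := by
  have h1 : ∀ v, (𝓕⁻ Φ : 𝓢(ℝ, ℂ)) (u - v) =
      𝓕 (fun ξ : ℝ => Complex.exp ((2 * Real.pi * u * ξ : ℝ) * Complex.I) * Φ ξ) v := fun v => by
    rw [fourier_modulation, SchwartzMap.fourierInv_coe, Real.fourierInv_eq_fourier_neg, neg_sub]
  have h2 : (𝓕⁻ Φ : 𝓢(ℝ, ℂ)) u =
      ∫ ξ : ℝ, Complex.exp ((2 * Real.pi * u * ξ : ℝ) * Complex.I) * Φ ξ := by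
    rw [SchwartzMap.fourierInv_coe, Real.fourierInv_eq']
    refine integral_congr_ae (Filter.Eventually.of_forall fun ξ => ?_)
    simp only [smul_eq_mul, RCLike.inner_apply, conj_trivial, mul_assoc]
  simp_rw [h1]
  rw [← integral_fourier_mul_eq_flip hh (integrable_modulation_mul Φ.integrable u), h2,
    ← integral_const_mul]
  refine integral_congr_ae (Filter.Eventually.of_forall fun ξ => ?_)
  simp only
  by_cases hξ : ξ ∈ tsupport Φ
  · rw [hc ξ (abs_le.2 ⟨(hΦ hξ).1.le, (hΦ hξ).2.le⟩)]
  · rw [image_eq_zero_of_notMem_tsupport hξ, mul_zero, mul_zero, mul_zero]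

/-- Convolution with an integrable function whose Fourier transform is constant on a neighbourhood
of the spectrum. -/
theorem IsReproducedOn.integral_mul_eq {a b M : ℝ} {m : ℝ → ℂ} (hm : IsReproducedOn a m)
    (ha : 0 < a) (hab : a < b) (hmc : Continuous m) (hmb : ∀ x, ‖m x‖ ≤ M) {h : ℝ → ℂ}
    (hh : Integrable h volume) {c : ℂ} (hc : ∀ ξ, |ξ| ≤ b → 𝓕 h ξ = c) (x : ℝ) :
    ∫ y, m y * h (x - y) = c * m x := by
  obtain ⟨Φ, hΦs, a', ha', hΦ⟩ := exists_schwartz_bump ha hab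
  set φ : 𝓢(ℝ, ℂ) := 𝓕⁻ Φ with hφ
  have hφF : ∀ ξ, |ξ| ≤ a' → 𝓕 (φ : ℝ → ℂ) ξ = 1 := fun ξ hξ => by
    rw [← SchwartzMap.fourier_coe, hφ, FourierTransform.fourier_fourierInv_eq, hΦ ξ hξ]
  have hrep := hm φ ⟨a', ha', hφF⟩
  have hhx : Integrable (fun y => h (x - y)) volume := hh.comp_sub_left x
  have hprod : Integrable (fun z : ℝ × ℝ => m z.1 * (h (x - z.2) * φ (z.2 - z.1)))
      ((volume : Measure ℝ).prod volume) := by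
    have hφn : Integrable (fun w => φ (-w)) volume := (φ.integrable (μ := volume)).comp_neg
    have := hhx.convolution_integrand (ContinuousLinearMap.mul ℝ ℂ) hφn
    simp only [neg_sub, ContinuousLinearMap.mul_apply'] at this
    exact this.bdd_mul (c := M) (hmc.comp continuous_fst).aestronglyMeasurable
      (Filter.Eventually.of_forall fun z => hmb z.1)
  -- This is `m ∗ h = (m ∗ φ) ∗ h = m ∗ (φ ∗ h) = c (m ∗ φ) = c m`.
  calc ∫ y, m y * h (x - y) = ∫ y, ∫ z, m z * (h (x - y) * φ (y - z)) := by
        refine integral_congr_ae (Filter.Eventually.of_forall fun y => ?_)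
        simp only
        rw [hrep y, ← integral_mul_const]
        refine integral_congr_ae (Filter.Eventually.of_forall fun z => ?_)
        simp only
        ring
    _ = ∫ z, ∫ y, m z * (h (x - y) * φ (y - z)) := (integral_integral_swap hprod).symm
    _ = ∫ z, c * (m z * φ (x - z)) := by
        refine integral_congr_ae (Filter.Eventually.of_forall fun z => ?_)
        simp only
        rw [integral_const_mul, ← integral_sub_left_eq_self _ volume x]
        have h1 := integral_schwartz_mul_eq hh hc Φ hΦs (x - z)
        rw [← hφ] at h1
        simp only [sub_sub_cancel]
        rw [mul_left_comm, ← h1]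
        congr 2
        ext v
        rw [sub_right_comm]
    _ = c * m x := by rw [integral_const_mul, ← hrep x]

/-- Fourier integral of a dilated function. -/
theorem fourier_dilation (h : ℝ → ℂ) {r : ℝ} (hr : 0 < r) (ξ : ℝ) :
    𝓕 (fun x : ℝ => (r⁻¹ : ℂ) * h (x / r)) ξ = 𝓕 h (r * ξ) := by
  rw [Real.fourier_real_eq_integral_exp_smul, Real.fourier_real_eq_integral_exp_smul]
  have h1 := Measure.integral_comp_div
    (fun v : ℝ => Complex.exp ((-2 * Real.pi * v * (r * ξ) : ℝ) * Complex.I) • h v) r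
  rw [abs_of_pos hr, eq_comm, ← eq_inv_smul_iff₀ hr.ne'] at h1
  rw [h1, ← integral_smul]
  refine integral_congr_ae (Filter.Eventually.of_forall fun v => ?_)
  simp only [smul_eq_mul, Complex.real_smul]
  rw [show -2 * Real.pi * (v / r) * (r * ξ) = -2 * Real.pi * v * ξ by field_simp]
  push_cast
  ring

/-- Convolution with an integrable function whose Fourier transform is constant on an interval
containing the spectrum. -/
theorem IsReproducedOn.integral_mul_eq_of_Icc {a M : ℝ} {m : ℝ → ℂ} (hm : IsReproducedOn a m)
    (ha : 0 < a) (hmc : Continuous m) (hmb : ∀ x, ‖m x‖ ≤ M) {h : ℝ → ℂ}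
    (hh : Integrable h volume) {c : ℂ} (hc : ∀ ξ, |ξ| ≤ a → 𝓕 h ξ = c) (x : ℝ) :
    ∫ y, m y * h (x - y) = c * m x := by
  -- Here `ĥ` is constant only on the band itself, with no margin. The dilate `r⁻¹ h(·/r)` has
  -- transform `ĥ(r ·)`, constant for `|ξ| ≤ a/r`, which is a margin when `r < 1`; dominated
  -- convergence then lets `r` tend to `1`.
  have hr : ∀ r ∈ Set.Ioo (0 : ℝ) 1, ∫ v, m (x - r * v) * h v = c * m x := fun r hr => by
    have h1 : Integrable (fun x : ℝ => (r⁻¹ : ℂ) * h (x / r)) volume :=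
      (hh.comp_div hr.1.ne').const_mul _
    have h2 := hm.integral_mul_eq ha (b := a / r)
      (by rw [lt_div_iff₀ hr.1]; nlinarith [hr.2]) hmc hmb h1 (c := c) (fun ξ hξ => by
        rw [fourier_dilation h hr.1]
        refine hc _ ?_
        rw [abs_mul, abs_of_pos hr.1, mul_comm]
        exact (le_div_iff₀ hr.1).1 hξ) x
    rw [← h2, ← integral_sub_left_eq_self (fun y => m y * ((r⁻¹ : ℂ) * h ((x - y) / r))) volume x]
    have h3 := Measure.integral_comp_div (fun v : ℝ => m (x - r * v) * h v) r
    rw [abs_of_pos hr.1, eq_comm, ← eq_inv_smul_iff₀ hr.1.ne'] at h3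
    rw [h3, ← integral_smul]
    refine integral_congr_ae (Filter.Eventually.of_forall fun v => ?_)
    simp only [Complex.real_smul, sub_sub_cancel]
    rw [mul_div_cancel₀ _ hr.1.ne']
    push_cast
    ring
  have hlim : Filter.Tendsto (fun r : ℝ => ∫ v, m (x - r * v) * h v) (nhdsWithin 1 (Set.Iio 1))
      (nhds (∫ v, m (x - 1 * v) * h v)) := by
    refine tendsto_integral_filter_of_dominated_convergence (fun v => M * ‖h v‖) ?_ ?_
      (hh.norm.const_mul M) ?_
    · refine Filter.Eventually.of_forall fun r => ?_
      exact (hmc.comp (continuous_const.sub (continuous_const.mul continuous_id))).aestronglyMeasurable.mul hh.1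
    · refine Filter.Eventually.of_forall fun r => Filter.Eventually.of_forall fun v => ?_
      rw [norm_mul]
      gcongr
      exact hmb _
    · refine Filter.Eventually.of_forall fun v => ?_
      have : Continuous fun r : ℝ => m (x - r * v) * h v :=
        (hmc.comp (continuous_const.sub (continuous_id.mul continuous_const))).mul continuous_const
      exact (this.tendsto 1).mono_left nhdsWithin_le_nhds
  have hev : (fun r : ℝ => ∫ v, m (x - r * v) * h v) =ᶠ[nhdsWithin 1 (Set.Iio 1)]
      fun _ => c * m x := by
    filter_upwards [Ioo_mem_nhdsLT zero_lt_one] with r h0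
    exact hr r h0
  rw [← tendsto_nhds_unique (hlim.congr' hev) tendsto_const_nhds,
    ← integral_sub_left_eq_self _ volume x]
  simp only [sub_sub_cancel, one_mul]

/-! ### Sampling kernels and Poisson summation. -/

theorem IsSamplingKernel.integrable {T Ω : ℝ} {s : ℝ → ℂ} (hs : IsSamplingKernel T Ω s) :
    Integrable s volume := memLp_one_iff_integrable.1 hs.memLp

theorem IsSamplingKernel.exists_summable_bound {T Ω : ℝ} {s : ℝ → ℂ} (hs : IsSamplingKernel T Ω s)
    (hT : 0 < T) (R : ℝ) :
    ∃ b : ℤ → ℝ, Summable b ∧ ∀ (k : ℤ) (z : ℝ), |z - k * T| ≤ R → ‖s z‖ ≤ b k :=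
  exists_summable_bound_of_mem_modulationSpace hs.continuous hs.memLp hs.mem_modulationSpace hT R

theorem continuous_fourier {s : ℝ → ℂ} (hs : Integrable s volume) : Continuous (𝓕 s) :=
  VectorFourier.fourierIntegral_continuous Real.continuous_fourierChar continuous_inner hs

/-- The right endpoint, missing from the half-open band, is recovered by continuity of `ŝ`. -/
theorem IsSamplingKernel.fourier_eq_of_abs_le {T Ω : ℝ} {s : ℝ → ℂ} (hs : IsSamplingKernel T Ω s)
    (hΩ : 0 < Ω) {ξ : ℝ} (hξ : |ξ| ≤ Ω / 2) : 𝓕 s ξ = T := by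
  have hcl : IsClosed {ξ | 𝓕 s ξ = (T : ℂ)} :=
    isClosed_eq (continuous_fourier hs.integrable) continuous_const
  have hsub : closure (Set.Ico (-Ω / 2) (Ω / 2)) ⊆ {ξ | 𝓕 s ξ = (T : ℂ)} :=
    closure_minimal hs.fourier_eq hcl
  rw [closure_Ico (by linarith)] at hsub
  rw [abs_le] at hξ
  exact hsub ⟨by linarith [hξ.1], hξ.2⟩

/-- The Fourier coefficients in Poisson's summation formula for `y ↦ m(Ty) s(x - Ty)`. -/
theorem IsSamplingKernel.fourier_mul_comp_sub {T Ω M : ℝ} {s m : ℝ → ℂ}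
    (hs : IsSamplingKernel T Ω s) (hT : 0 < T) (hΩ : 0 < Ω) (hTΩ : T * Ω < 1)
    (hm : IsReproducedOn (Ω / 2) m) (hmc : Continuous m) (hmb : ∀ x, ‖m x‖ ≤ M) (x : ℝ) (n : ℤ) :
    𝓕 (fun y : ℝ => m (y * T) * s (x - y * T)) (n : ℝ) = if n = 0 then m x else 0 := by
  set h : ℝ → ℂ := fun w =>
    Complex.exp ((2 * Real.pi * (n / T) * w : ℝ) * Complex.I) * s w with hh
  have h1 : 𝓕 (fun y : ℝ => m (y * T) * s (x - y * T)) (n : ℝ) =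
      (T⁻¹ : ℂ) * (Complex.exp ((-2 * Real.pi * (n / T) * x : ℝ) * Complex.I) *
        ∫ v, m v * h (x - v)) := by
    rw [Real.fourier_real_eq_integral_exp_smul, ← integral_const_mul]
    have h3 := Measure.integral_comp_mul_right (fun v : ℝ =>
      Complex.exp ((-2 * Real.pi * (n / T) * x : ℝ) * Complex.I) * (m v * h (x - v))) T
    rw [abs_of_pos (inv_pos.2 hT), Complex.real_smul] at h3
    push_cast at h3 ⊢
    rw [← h3]
    refine integral_congr_ae (Filter.Eventually.of_forall fun y => ?_)
    simp only [smul_eq_mul, hh]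
    have he : Complex.exp (-2 * Real.pi * y * n * Complex.I) =
        Complex.exp (-2 * Real.pi * (n / T) * x * Complex.I) *
        Complex.exp ((2 * Real.pi * (n / T) * (x - y * T) : ℝ) * Complex.I) := by
      rw [← Complex.exp_add]
      congr 1
      have : (T : ℂ) ≠ 0 := Complex.ofReal_ne_zero.2 hT.ne'
      push_cast
      field_simp
      ring
    rw [he]
    ring
  have hhi : Integrable h volume := integrable_modulation_mul hs.integrable _
  have hFh : ∀ ξ, 𝓕 h ξ = 𝓕 s (ξ - n / T) := fun ξ => fourier_modulation s (n / T) ξ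
  have ha : 0 < Ω / 2 := by linarith
  rw [h1]
  split_ifs with hn
  · subst hn
    have h2 := hm.integral_mul_eq_of_Icc ha hmc hmb hhi (c := T) (fun ξ hξ => by
      rw [hFh, Int.cast_zero, zero_div, sub_zero]
      exact hs.fourier_eq_of_abs_le hΩ hξ) x
    rw [h2]
    have : (T : ℂ) ≠ 0 := Complex.ofReal_ne_zero.2 hT.ne'
    simp only [Int.cast_zero, zero_div, mul_zero, zero_mul, Complex.ofReal_zero, Complex.exp_zero,
      one_mul]
    rw [inv_mul_cancel_left₀ this]
  · have hlt : Ω < 1 / T := by rw [lt_div_iff₀ hT]; linarith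
    have h12 : 1 / (2 * T) = 1 / T / 2 := by field_simp
    -- The radius is the midpoint of `Ω/2` and `1/(2T)`. For `|ξ|` up to it and `n ≠ 0`, `|ξ - n/T|`
    -- exceeds `1/(2T)`, so the shifted transform vanishes.
    have h2 := hm.integral_mul_eq ha (b := (Ω / 2 + 1 / T / 2) / 2) (by linarith) hmc hmb hhi
      (c := 0) (fun ξ hξ => by
        rw [hFh]
        by_contra hne
        have hmem := hs.tsupport_fourier (subset_tsupport _ hne)
        rw [neg_div, h12] at hmem
        have hξ' := abs_le.1 hξ
        have h1T : 0 < 1 / T := by positivity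
        have hdiv : (n : ℝ) / T = n * (1 / T) := by ring
        rw [hdiv] at hmem
        rcases lt_or_gt_of_ne hn with hneg | hpos
        · have : (n : ℝ) ≤ -1 := by exact_mod_cast Int.le_sub_one_of_lt hneg
          nlinarith [hmem.2]
        · have : (1 : ℝ) ≤ n := by exact_mod_cast hpos
          nlinarith [hmem.1]) x
    rw [h2, zero_mul, mul_zero, mul_zero]

/-- The sampling series converges pointwise. -/
theorem IsSamplingKernel.hasSum {T Ω M : ℝ} {s m : ℝ → ℂ}
    (hs : IsSamplingKernel T Ω s) (hT : 0 < T) (hΩ : 0 < Ω) (hTΩ : T * Ω < 1)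
    (hm : IsReproducedOn (Ω / 2) m) (hmc : Continuous m) (hmb : ∀ x, ‖m x‖ ≤ M) (x : ℝ) :
    HasSum (fun k : ℤ => m (k * T) * s (x - k * T)) (m x) := by
  set F : C(ℝ, ℂ) := ⟨fun y => m (y * T) * s (x - y * T), by
    have := hs.continuous
    fun_prop⟩ with hF
  have hM : 0 ≤ M := (norm_nonneg _).trans (hmb 0)
  have hFF : ∀ n : ℤ, 𝓕 (F : ℝ → ℂ) n = if n = 0 then m x else 0 := fun n =>
    hs.fourier_mul_comp_sub hT hΩ hTΩ hm hmc hmb x n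
  -- Locally uniform summability, required for Poisson summation: for `|y| ≤ |R|` the point `x - (y
  -- + n)T` is within `|x| + |R|T` of `-nT`, whence the index `-n`.
  have hnorm : ∀ K : TopologicalSpace.Compacts ℝ,
      Summable fun n : ℤ => ‖(F.comp <| ContinuousMap.addRight n).restrict K‖ := fun K => by
    obtain ⟨R, hR⟩ := K.isCompact.isBounded.exists_norm_le
    obtain ⟨b, hb, hbs⟩ := hs.exists_summable_bound hT (|x| + |R| * T)
    have hb' : Summable fun n : ℤ => M * |b (-n)| := ((Equiv.neg ℤ).summable_iff.2 hb.abs).mul_left M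
    refine hb'.of_nonneg_of_le (fun _ => norm_nonneg _) fun n => ?_
    rw [ContinuousMap.norm_le _ (by positivity)]
    rintro ⟨y, hy⟩
    change ‖m ((y + n) * T) * s (x - (y + n) * T)‖ ≤ _
    rw [norm_mul]
    gcongr
    · exact hmb _
    · refine (hbs (-n) _ ?_).trans (le_abs_self _)
      have hyR : |y| ≤ |R| := (hR y hy).trans (le_abs_self R)
      have : x - (y + n) * T - (-n : ℤ) * T = x - y * T := by push_cast; ring
      rw [this]
      refine (abs_sub _ _).trans ?_
      rw [abs_mul, abs_of_pos hT]
      gcongr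
  have hP := Real.tsum_eq_tsum_fourier hnorm
    (summable_of_ne_finset_zero (s := {0}) fun n hn => by rw [hFF, if_neg (by simpa using hn)]) 0
  have hsum : Summable fun k : ℤ => m (k * T) * s (x - k * T) := by
    obtain ⟨C, hC⟩ := exists_summable_bound_sub hT (hs.exists_summable_bound hT)
    refine Summable.of_norm_bounded ((hC x).1.mul_left M) fun k => ?_
    rw [norm_mul]
    gcongr
    exact hmb _
  refine (Summable.hasSum_iff hsum).2 ?_
  have h0 : ∀ n : ℤ, F (0 + n) = m (n * T) * s (x - n * T) := fun n => by
    rw [zero_add]; rfl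
  simp_rw [h0, hFF] at hP
  rw [hP, tsum_eq_single 0 fun n hn => by rw [if_neg hn, zero_mul]]
  simp

/-! ### Schwartz functions as elements of the Feichtinger algebra. -/

theorem norm_fourier_mul_comp_sub_le (φ G : 𝓢(ℝ, ℂ)) (t ν : ℝ) :
    ‖𝓕 (fun y : ℝ => φ y * G (y - t)) ν‖ ≤ ∫ y, ‖φ y‖ * ‖G (y - t)‖ := by
  rw [Real.fourier_eq]
  refine (norm_integral_le_integral_norm _).trans_eq ?_
  simp only [Circle.norm_smul, norm_mul]

theorem SchwartzMap.integrable_mul_comp_sub (φ G : 𝓢(ℝ, ℂ)) (t : ℝ) :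
    Integrable (fun y : ℝ => φ y * G (y - t)) volume := by
  refine φ.integrable.mul_bdd (c := SchwartzMap.seminorm ℝ 0 0 G)
    (G.continuous.comp (continuous_id.sub continuous_const)).aestronglyMeasurable
    (Filter.Eventually.of_forall fun y => SchwartzMap.norm_le_seminorm ℝ G _)

/-- Two-fold integrability of a product with a translate. -/
theorem SchwartzMap.integrable_integral_norm_mul_comp_sub (φ G : 𝓢(ℝ, ℂ)) :
    Integrable (fun t : ℝ => ∫ y, ‖φ y‖ * ‖G (y - t)‖) volume := by
  have hG : Integrable (fun w => ‖G (-w)‖) volume := (G.integrable (μ := volume)).norm.comp_neg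
  have := (φ.integrable (μ := volume)).norm.convolution_integrand (ContinuousLinearMap.mul ℝ ℝ) hG
  simp only [neg_sub, ContinuousLinearMap.mul_apply'] at this
  exact this.integral_prod_left

/-- A power of `ν` is traded for a derivative, distributed by the Leibniz rule; the factor `2π ≥ 1`
is discarded. Two applications yield decay of order `ν⁻²`. -/
theorem abs_mul_norm_fourier_mul_comp_sub_le (φ G : 𝓢(ℝ, ℂ)) (t ν : ℝ) :
    |ν| * ‖𝓕 (fun y : ℝ => φ y * G (y - t)) ν‖ ≤
      ‖𝓕 (fun y : ℝ => SchwartzMap.derivCLM ℝ ℂ φ y * G (y - t)) ν‖ +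
      ‖𝓕 (fun y : ℝ => φ y * SchwartzMap.derivCLM ℝ ℂ G (y - t)) ν‖ := by
  have hd : ∀ y, HasDerivAt (fun y : ℝ => φ y * G (y - t))
      (SchwartzMap.derivCLM ℝ ℂ φ y * G (y - t) + φ y * SchwartzMap.derivCLM ℝ ℂ G (y - t)) y :=
    fun y => (φ.differentiableAt.hasDerivAt).mul
      ((G.differentiableAt (x := y - t)).hasDerivAt.comp_sub_const y t)
  have hi1 := SchwartzMap.integrable_mul_comp_sub (SchwartzMap.derivCLM ℝ ℂ φ) G t
  have hi2 := SchwartzMap.integrable_mul_comp_sub φ (SchwartzMap.derivCLM ℝ ℂ G) t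
  have hderiv : deriv (fun y : ℝ => φ y * G (y - t)) = (fun y =>
      SchwartzMap.derivCLM ℝ ℂ φ y * G (y - t)) + fun y =>
        φ y * SchwartzMap.derivCLM ℝ ℂ G (y - t) := funext fun y => (hd y).deriv
  have h1 := congrFun (Real.fourier_deriv (SchwartzMap.integrable_mul_comp_sub φ G t)
    (fun y => (hd y).differentiableAt) (hderiv ▸ hi1.add hi2)) ν
  rw [hderiv] at h1
  have h2 : 𝓕 ((fun y => SchwartzMap.derivCLM ℝ ℂ φ y * G (y - t)) + fun y =>
        φ y * SchwartzMap.derivCLM ℝ ℂ G (y - t)) ν =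
      𝓕 (fun y : ℝ => SchwartzMap.derivCLM ℝ ℂ φ y * G (y - t)) ν +
      𝓕 (fun y : ℝ => φ y * SchwartzMap.derivCLM ℝ ℂ G (y - t)) ν := by
    simp only [Real.fourier_eq, Pi.add_apply, smul_add]
    exact integral_add ((Real.fourierIntegral_convergent_iff ν).2 hi1)
      ((Real.fourierIntegral_convergent_iff ν).2 hi2)
  refine le_trans ?_ (norm_add_le _ _)
  rw [← h2, h1, norm_smul]
  refine mul_le_mul_of_nonneg_right ?_ (norm_nonneg _)
  simp only [norm_mul, Complex.norm_ofNat, Complex.norm_real, Complex.norm_I, mul_one,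
    Real.norm_eq_abs, abs_of_pos Real.pi_pos]
  exact le_mul_of_one_le_left (abs_nonneg ν) (by linarith [Real.pi_gt_three])

/-- Schwartz functions belong to the Feichtinger algebra. -/
theorem SchwartzMap.mem_modulationSpaceOneOne (φ : 𝓢(ℝ, ℂ))
    (hφ : MemLp φ 1 (volume : Measure ℝ)) :
    ((hφ.toLp φ : Lp ℂ 1 (volume : Measure ℝ)) : 𝓢'(ℝ, ℂ)) ∈ modulationSpaceOneOne := by
  set G : 𝓢(ℝ, ℂ) := conjTFGaussian 0 0 with hG
  have hGa : ∀ x, G x = (realGaussian x : ℂ) := fun x => by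
    change (starRingEnd ℂ) (tfGaussian 0 0 x) = _
    rw [conj_tfGaussian]
    simp
  have hV : ∀ z : ℝ × ℝ,
      gaussianSTFT ((hφ.toLp φ : Lp ℂ 1 (volume : Measure ℝ)) : 𝓢'(ℝ, ℂ)) z =
        𝓕 (fun y : ℝ => φ y * G (y - z.1)) z.2 := fun z => by
    simp_rw [hGa]
    exact gaussianSTFT_toLp hφ z.1 z.2
  set D := SchwartzMap.derivCLM ℝ ℂ
  set c : 𝓢(ℝ, ℂ) → 𝓢(ℝ, ℂ) → ℝ → ℝ := fun f g t => ∫ y, ‖f y‖ * ‖g (y - t)‖ with hc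
  have hci : ∀ f g, Integrable (c f g) volume := SchwartzMap.integrable_integral_norm_mul_comp_sub
  have hle : ∀ f g : 𝓢(ℝ, ℂ), ∀ t ν, ‖𝓕 (fun y : ℝ => f y * g (y - t)) ν‖ ≤ c f g t :=
    norm_fourier_mul_comp_sub_le
  -- `E(t)` dominates `(1 + ν²)|V(t, ν)|`: the first term handles `1`, the other four come from
  -- using the derivative estimate twice for `ν²`.
  set E : ℝ → ℝ := fun t => c φ G t + (c (D (D φ)) G t + c (D φ) (D G) t +
    (c (D φ) (D G) t + c φ (D (D G)) t)) with hE
  have hEi : Integrable E volume :=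
    (hci _ _).add (((hci _ _).add (hci _ _)).add ((hci _ _).add (hci _ _)))
  change Integrable _ ((volume : Measure ℝ).prod volume)
  refine (hEi.mul_prod integrable_inv_one_add_sq).mono' ?_
    (Filter.Eventually.of_forall fun z => ?_)
  · refine StronglyMeasurable.aestronglyMeasurable ?_
    simp_rw [funext hV, Real.fourier_real_eq_integral_exp_smul]
    have : Continuous fun q : (ℝ × ℝ) × ℝ =>
        Complex.exp ((-2 * Real.pi * q.2 * q.1.2 : ℝ) * Complex.I) •
          (φ q.2 * G (q.2 - q.1.1)) := by
      have h1 := φ.continuous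
      have h2 := G.continuous
      fun_prop
    exact this.stronglyMeasurable.integral_prod_right'
  · rw [hV, ← div_eq_mul_inv, le_div_iff₀ (by positivity), mul_add, mul_one]
    have h1 := abs_mul_norm_fourier_mul_comp_sub_le φ G z.1 z.2
    have h2 := abs_mul_norm_fourier_mul_comp_sub_le (D φ) G z.1 z.2
    have h3 := abs_mul_norm_fourier_mul_comp_sub_le φ (D G) z.1 z.2
    have h4 := mul_le_mul_of_nonneg_left h1 (abs_nonneg z.2)
    rw [← mul_assoc, ← sq, sq_abs, mul_comm] at h4
    have e0 := hle φ G z.1 z.2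
    have e1 := hle (D (D φ)) G z.1 z.2
    have e2 := hle (D φ) (D G) z.1 z.2
    have e3 := hle φ (D (D G)) z.1 z.2
    simp only [hE]
    linarith

/-- Schwartz sampling kernels exist. -/
theorem exists_schwartz_isSamplingKernel {T Ω : ℝ} (hT : 0 < T) (hΩ : 0 < Ω) (hTΩ : T * Ω < 1) :
    ∃ s : 𝓢(ℝ, ℂ), IsSamplingKernel T Ω s ∧
      ∃ a' > Ω / 2, ∀ ξ, |ξ| ≤ a' → 𝓕 (s : ℝ → ℂ) ξ = T := by
  have hlt : Ω / 2 < 1 / (2 * T) := by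
    rw [div_lt_div_iff₀ two_pos (by positivity)]; linarith
  -- Strict oversampling `TΩ < 1` is what leaves room for a smooth cutoff, with a margin `a'` beyond
  -- the band.
  obtain ⟨Φ, hΦs, a', ha', hΦ⟩ := exists_schwartz_bump (by linarith) hlt
  set s : 𝓢(ℝ, ℂ) := (T : ℂ) • (𝓕⁻ Φ : 𝓢(ℝ, ℂ)) with hs
  have hF : 𝓕 (s : ℝ → ℂ) = fun ξ => (T : ℂ) * Φ ξ := by
    ext ξ
    rw [← SchwartzMap.fourier_coe, hs, FourierTransform.fourier_smul,
      FourierTransform.fourier_fourierInv_eq]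
    rfl
  have hF1 : ∀ ξ, |ξ| ≤ a' → 𝓕 (s : ℝ → ℂ) ξ = T := fun ξ hξ => by
    rw [hF]; simp only [hΦ ξ hξ, mul_one]
  refine ⟨s, ⟨s.continuous, s.memLp 1 volume, s.mem_modulationSpaceOneOne _, ?_, ?_⟩, a', ha', hF1⟩
  · rw [hF, neg_div]
    exact (tsupport_mul_subset_right.trans hΦs).trans Set.Ioo_subset_Ico_self
  · intro ξ hξ
    refine hF1 ξ (abs_le.2 ⟨?_, ?_⟩)
    · rw [neg_div] at hξ; linarith [hξ.1]
    · linarith [hξ.2]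

/-! ### Sampling and synthesis between `L^p` and `ℓ^p`. -/

/-- The marginals of the kernel `s (x - kT)` are bounded. -/
theorem exists_nnreal_bound {s : ℝ → ℂ} (hs : Integrable s volume) {T : ℝ} (hT : 0 < T)
    (h : ∀ R : ℝ, ∃ b : ℤ → ℝ, Summable b ∧ ∀ (k : ℤ) (z : ℝ), |z - k * T| ≤ R → ‖s z‖ ≤ b k) :
    ∃ C : ℝ≥0, 0 < C ∧ ∫⁻ x, ‖s x‖ₑ ≤ C ∧ ∀ x : ℝ, ∑' k : ℤ, ‖s (x - k * T)‖ₑ ≤ C := by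
  obtain ⟨D, hD⟩ := exists_summable_bound_sub hT h
  -- The maximum with `1` keeps the constant positive, so that its inverse can serve as a lower
  -- frame bound.
  refine ⟨max (max D.toNNReal (∫⁻ x, ‖s x‖ₑ).toNNReal) 1, by simp, ?_, fun x => ?_⟩
  · calc ∫⁻ x, ‖s x‖ₑ = ((∫⁻ x, ‖s x‖ₑ).toNNReal : ℝ≥0∞) :=
          (ENNReal.coe_toNNReal hs.2.ne).symm
      _ ≤ _ := by
          rw [ENNReal.coe_le_coe]
          exact (le_max_right _ _).trans (le_max_left _ _)
  · calc ∑' k : ℤ, ‖s (x - k * T)‖ₑ = ENNReal.ofReal (∑' k : ℤ, ‖s (x - k * T)‖) := by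
          rw [ENNReal.ofReal_tsum_of_nonneg (fun _ => norm_nonneg _) (hD x).1]
          simp only [ofReal_norm]
      _ ≤ ENNReal.ofReal D := ENNReal.ofReal_le_ofReal (hD x).2
      _ ≤ _ := by
          rw [ENNReal.ofReal, ENNReal.coe_le_coe]
          exact (le_max_left _ _).trans (le_max_left _ _)

/-- Synthesis estimate: series of translates along a lattice are bounded from `ℓ^p` to `L^p`. -/
theorem eLpNorm_le_of_enorm_le_tsum {p : ℝ≥0∞} (hp : 1 ≤ p) {T : ℝ} {s g : ℝ → ℂ} {c : ℤ → ℂ}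
    {C : ℝ≥0∞} (hs : Continuous s) (h1 : ∫⁻ x, ‖s x‖ₑ ≤ C)
    (h2 : ∀ x : ℝ, ∑' k : ℤ, ‖s (x - k * T)‖ₑ ≤ C)
    (hg : ∀ x, ‖g x‖ₑ ≤ ∑' k : ℤ, ‖s (x - k * T)‖ₑ * ‖c k‖ₑ) :
    eLpNorm g p volume ≤ C * eLpNorm c p Measure.count := by
  have hK : Measurable (Function.uncurry fun (x : ℝ) (k : ℤ) => ‖s (x - k * T)‖ₑ) := by
    refine measurable_from_prod_countable_left fun k => ?_
    have : Continuous fun x : ℝ => s (x - k * T) := by fun_prop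
    exact this.enorm.measurable
  have h := eLpNorm_lintegral_kernel_le (μ := (volume : Measure ℝ))
    (ν := (Measure.count : Measure ℤ)) hp hK
    (measurable_of_countable fun k => ‖c k‖ₑ) (C := C)
    (fun x => by rw [lintegral_count]; exact h2 x)
    (fun k => by rw [lintegral_sub_right_eq_self (fun x => ‖s x‖ₑ)]; exact h1)
  rw [eLpNorm_enorm] at h
  refine (eLpNorm_mono_enorm fun x => ?_).trans h
  rw [lintegral_count, enorm_eq_self]
  exact hg x

/-- Sampling estimate: the samples of a convolution are bounded from `L^p` to `ℓ^p`. -/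
theorem eLpNorm_samples_le {p : ℝ≥0∞} (hp : 1 ≤ p) {T : ℝ} {s m : ℝ → ℂ}
    {C : ℝ≥0∞} (hs : Continuous s) (h1 : ∫⁻ x, ‖s x‖ₑ ≤ C)
    (h2 : ∀ x : ℝ, ∑' k : ℤ, ‖s (x - k * T)‖ₑ ≤ C) (hm : StronglyMeasurable m) :
    eLpNorm (fun k : ℤ => ∫ y, m y * s (k * T - y)) p Measure.count ≤ C * eLpNorm m p volume := by
  have hK : Measurable (Function.uncurry fun (k : ℤ) (y : ℝ) => ‖s (k * T - y)‖ₑ) := by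
    refine measurable_from_prod_countable_right fun k => ?_
    have : Continuous fun y : ℝ => s (k * T - y) := by fun_prop
    exact this.enorm.measurable
  have h := eLpNorm_lintegral_kernel_le (ν := (volume : Measure ℝ))
    (μ := (Measure.count : Measure ℤ)) hp hK hm.enorm (C := C)
    (fun k => by rw [lintegral_sub_left_eq_self (fun x => ‖s x‖ₑ)]; exact h1)
    -- Since `kT - y = (-y) - (-k)T`, the column sum is the lattice sum at `-y` after `k ↦ -k`.
    (fun y => by
      rw [lintegral_count, ← (Equiv.neg ℤ).tsum_eq]
      refine le_trans (le_of_eq (tsum_congr fun k => ?_)) (h2 (-y))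
      congr 2
      simp only [Equiv.neg_apply]
      push_cast
      ring)
  rw [eLpNorm_enorm] at h
  refine (eLpNorm_mono_enorm fun k => ?_).trans h
  rw [enorm_eq_self]
  refine (enorm_integral_le_lintegral_enorm _).trans_eq ?_
  simp only [enorm_mul, mul_comm]

/-- A convergent series is dominated by the series of the norms. -/
theorem HasSum.enorm_le_tsum {f : ℤ → ℂ} {a : ℂ} (h : HasSum f a) : ‖a‖ₑ ≤ ∑' k, ‖f k‖ₑ := by
  refine le_of_tendsto h.enorm (Filter.Eventually.of_forall fun F => ?_)
  exact (enorm_sum_le _ _).trans (ENNReal.sum_le_tsum F)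

/-- The tails of an `ℓ^p` sequence tend to zero for finite `p`. -/
theorem tendsto_eLpNorm_count_compl {p : ℝ≥0∞} (hp : 1 ≤ p) (hpt : p ≠ ∞) {c : ℤ → ℂ}
    (hc : eLpNorm c p Measure.count ≠ ∞) :
    Filter.Tendsto (fun F : Finset ℤ => eLpNorm (fun k => if k ∈ F then 0 else c k) p Measure.count)
      Filter.atTop (nhds 0) := by
  have hp0 : p ≠ 0 := (zero_lt_one.trans_le hp).ne'
  have hq0 : 0 < p.toReal := ENNReal.toReal_pos hp0 hpt
  have hsum : ∑' k, ‖c k‖ₑ ^ p.toReal ≠ ∞ := by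
    rw [eLpNorm_eq_lintegral_rpow_enorm_toReal hp0 hpt, lintegral_count] at hc
    intro h
    rw [h, ENNReal.top_rpow_of_pos (by positivity)] at hc
    exact hc rfl
  have h := (ENNReal.tendsto_tsum_compl_atTop_zero hsum).ennrpow_const (1 / p.toReal)
  rw [ENNReal.zero_rpow_of_pos (by positivity)] at h
  refine h.congr fun F => ?_
  rw [eLpNorm_eq_lintegral_rpow_enorm_toReal hp0 hpt, lintegral_count]
  congr 1
  rw [← tsum_subtype_eq_of_support_subset (s := {k | k ∉ F})]
  · refine tsum_congr fun k => ?_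
    have := k.2
    rw [if_neg this]
  · intro k hk hkF
    refine hk ?_
    simp only
    rw [if_pos hkF, enorm_zero, ENNReal.zero_rpow_of_pos hq0]

/-! ### The continuous representative and the sampling theorem. -/

/-- A bandlimited function in `L^p` has a continuous bounded representative, given by convolution
with a Schwartz function, that is reproduced on its spectrum. -/
theorem IsBandlimited.exists_representative {p : ℝ≥0∞} [Fact (1 ≤ p)] {Ω a' : ℝ} (ha' : Ω / 2 < a')
    {m : Lp ℂ p (volume : Measure ℝ)} (hm : IsBandlimited Ω m) (φ : 𝓢(ℝ, ℂ))
    (hφ : ∀ ξ, |ξ| ≤ a' → 𝓕 (φ : ℝ → ℂ) ξ = 1) :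
    ∃ m₀ : ℝ → ℂ, Continuous m₀ ∧ m =ᵐ[volume] m₀ ∧ (∃ M, ∀ x, ‖m₀ x‖ ≤ M) ∧
      IsReproducedOn (Ω / 2) m₀ ∧ ∀ x, m₀ x = ∫ y, m y * φ (x - y) := by
  have hsub : Distribution.dsupport (𝓕 (m : 𝓢'(ℝ, ℂ)) : 𝓢'(ℝ, ℂ)) ⊆ Set.Icc (-(Ω / 2)) (Ω / 2) := by
    refine hm.trans ?_
    rw [neg_div]
    exact Set.Ico_subset_Icc_self
  have hmm := Lp.memLp m
  have hmi := hmm.integrable_mul_inv_one_add_sq Fact.out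
  have hae := ae_eq_integral_mul_schwartz ha' m hsub φ hφ
  have hcont := continuous_integral_mul_schwartz hmm.1 hmi φ
  refine ⟨_, hcont, hae, exists_norm_integral_mul_schwartz_le Fact.out hmm φ, ?_, fun _ => rfl⟩
  rintro ψ ⟨b, hb, hψ⟩ x
  have hae' := ae_eq_integral_mul_schwartz hb m hsub ψ hψ
  -- Two continuous functions that agree almost everywhere agree everywhere, so every admissible `ψ`
  -- gives the same representative.
  have heq := congrFun (((hcont.ae_eq_iff_eq volume
    (continuous_integral_mul_schwartz hmm.1 hmi ψ)).1 (hae.symm.trans hae'))) x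
  refine heq.trans (integral_congr_ae ?_)
  filter_upwards [hae] with y hy
  rw [← hy]

theorem mainTheorem7 (p : ℝ≥0∞) [Fact (1 ≤ p)] (T Ω : ℝ) (hT : 0 < T) (hΩ : 0 < Ω)
    (hTΩ : T * Ω < 1) :
    (∃ s : ℝ → ℂ, IsSamplingKernel T Ω s) ∧
    ∃ A B : ℝ≥0, 0 < A ∧ 0 < B ∧
      ∀ m : Lp ℂ p (volume : Measure ℝ), IsBandlimited Ω m →
        ∃ m₀ : ℝ → ℂ, Continuous m₀ ∧ m =ᵐ[volume] m₀ ∧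
          (A : ℝ≥0∞) * eLpNorm m p volume ≤
            eLpNorm (fun k : ℤ => m₀ (k * T)) p Measure.count ∧
          eLpNorm (fun k : ℤ => m₀ (k * T)) p Measure.count ≤
            (B : ℝ≥0∞) * eLpNorm m p volume ∧
          ∀ s : ℝ → ℂ, IsSamplingKernel T Ω s →
            (∀ x : ℝ, HasSum (fun k : ℤ => m₀ (k * T) * s (x - k * T)) (m₀ x)) ∧
            (p ≠ ∞ → Filter.Tendsto
              (fun F : Finset ℤ => eLpNorm
                (fun x : ℝ => m₀ x - ∑ k ∈ F, m₀ (k * T) * s (x - k * T)) p volume)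
              Filter.atTop (nhds 0)) ∧
            (p = ∞ → ∀ g : ℝ → ℂ, Integrable g volume → Filter.Tendsto
              (fun F : Finset ℤ => ∫ x : ℝ, (∑ k ∈ F, m₀ (k * T) * s (x - k * T)) * g x)
              Filter.atTop (nhds (∫ x : ℝ, m₀ x * g x))) := by
  have hp : 1 ≤ p := Fact.out
  obtain ⟨s₀, hs₀, a', ha', hF⟩ := exists_schwartz_isSamplingKernel hT hΩ hTΩ
  refine ⟨⟨s₀, hs₀⟩, ?_⟩
  obtain ⟨C, hC0, hC1, hC2⟩ := exists_nnreal_bound hs₀.integrable hT (hs₀.exists_summable_bound hT)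
  -- One Schwartz kernel plays both roles: `s₀` synthesises, giving `A = C⁻¹`, and `φ = T⁻¹ s₀`
  -- reproduces, giving `B`. Both constants are fixed before `m` and `s`.
  set φ : 𝓢(ℝ, ℂ) := (T⁻¹ : ℂ) • s₀ with hφ
  have hTc : (T : ℂ) ≠ 0 := Complex.ofReal_ne_zero.2 hT.ne'
  have hφF : ∀ ξ, |ξ| ≤ a' → 𝓕 (φ : ℝ → ℂ) ξ = 1 := fun ξ hξ => by
    rw [← SchwartzMap.fourier_coe, hφ, FourierTransform.fourier_smul]
    change (T⁻¹ : ℂ) * 𝓕 (s₀ : ℝ → ℂ) ξ = 1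
    rw [hF ξ hξ, inv_mul_cancel₀ hTc]
  have hφ1 := φ.memLp 1 (volume : Measure ℝ)
  obtain ⟨B, hB0, hB1, hB2⟩ := exists_nnreal_bound φ.integrable hT
    (exists_summable_bound_of_mem_modulationSpace φ.continuous hφ1
      (φ.mem_modulationSpaceOneOne hφ1) hT)
  refine ⟨C⁻¹, B, inv_pos.2 hC0, hB0, fun m hm => ?_⟩
  obtain ⟨m₀, hmc, hae, ⟨M, hM⟩, hrep, hconv⟩ := hm.exists_representative ha' φ hφF
  have hsamp : eLpNorm (fun k : ℤ => m₀ (k * T)) p Measure.count ≤ B * eLpNorm m p volume := by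
    simp_rw [hconv]
    exact eLpNorm_samples_le hp φ.continuous hB1 hB2 (Lp.stronglyMeasurable m)
  refine ⟨m₀, hmc, hae, ?_, hsamp, fun s hs => ?_⟩
  · have h := eLpNorm_le_of_enorm_le_tsum hp (g := m₀) (c := fun k => m₀ (k * T)) hs₀.continuous
      hC1 hC2 fun x => by
        refine (hs₀.hasSum hT hΩ hTΩ hrep hmc hM x).enorm_le_tsum.trans_eq ?_
        simp only [enorm_mul, mul_comm]
    rw [eLpNorm_congr_ae hae, ENNReal.coe_inv hC0.ne']
    exact (ENNReal.inv_mul_le_iff (by exact_mod_cast hC0.ne') ENNReal.coe_ne_top).2 h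
  have hsum := hs.hasSum hT hΩ hTΩ hrep hmc hM
  refine ⟨hsum, fun hpt => ?_, fun _ g hg => ?_⟩
  · obtain ⟨D, -, hD1, hD2⟩ := exists_nnreal_bound hs.integrable hT (hs.exists_summable_bound hT)
    -- The remainder of a partial sum is the synthesis of the samples outside `F`, so its norm is at
    -- most `D` times a vanishing `ℓ^p` tail.
    have htail := ENNReal.Tendsto.const_mul (a := (D : ℝ≥0∞)) (tendsto_eLpNorm_count_compl hp hpt
      (hsamp.trans_lt (ENNReal.mul_lt_top ENNReal.coe_lt_top (Lp.eLpNorm_lt_top m))).ne)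
      (Or.inr ENNReal.coe_ne_top)
    rw [mul_zero] at htail
    refine tendsto_of_tendsto_of_tendsto_of_le_of_le tendsto_const_nhds htail
      (fun _ => zero_le) fun F => ?_
    refine eLpNorm_le_of_enorm_le_tsum hp hs.continuous hD1 hD2 fun x => ?_
    have hfin : HasSum (fun k : ℤ => if k ∈ F then m₀ (k * T) * s (x - k * T) else 0)
        (∑ k ∈ F, m₀ (k * T) * s (x - k * T)) := by
      rw [← Finset.sum_congr rfl fun k hk => if_pos (c := k ∈ F) hk]
      exact hasSum_sum_of_ne_finset_zero fun k hk => if_neg hk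
    refine ((hsum x).sub hfin).enorm_le_tsum.trans_eq (tsum_congr fun k => ?_)
    rw [← enorm_mul]
    split_ifs <;> simp [mul_comm]
  · obtain ⟨D, hD⟩ := exists_summable_bound_sub hT (hs.exists_summable_bound hT)
    have hM0 : 0 ≤ M := (norm_nonneg _).trans (hM 0)
    -- All partial sums are bounded by `M * D`, uniformly in `F` and `x`, so pointwise convergence
    -- passes to the pairing with `g`.
    refine tendsto_integral_filter_of_dominated_convergence (fun x => M * D * ‖g x‖) ?_ ?_
      (hg.norm.const_mul _) ?_
    · refine Filter.Eventually.of_forall fun F => ?_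
      have hcs := hs.continuous
      have : Continuous fun x : ℝ => ∑ k ∈ F, m₀ (k * T) * s (x - k * T) := by fun_prop
      exact this.aestronglyMeasurable.mul hg.1
    · refine Filter.Eventually.of_forall fun F => Filter.Eventually.of_forall fun x => ?_
      rw [norm_mul]
      refine mul_le_mul_of_nonneg_right ?_ (norm_nonneg _)
      calc ‖∑ k ∈ F, m₀ (k * T) * s (x - k * T)‖ ≤ ∑ k ∈ F, M * ‖s (x - k * T)‖ := by
            refine norm_sum_le_of_le _ fun k _ => ?_
            rw [norm_mul]
            exact mul_le_mul_of_nonneg_right (hM _) (norm_nonneg _)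
        _ ≤ M * D := by
            rw [← Finset.mul_sum]
            refine mul_le_mul_of_nonneg_left ?_ hM0
            exact ((hD x).1.sum_le_tsum F fun _ _ => norm_nonneg _).trans (hD x).2
    · exact Filter.Eventually.of_forall fun x => (hsum x).mul_const (g x)
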